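/- Let $d\ge 1$, let $\Omega\subset\mathbb R^d$ be open and bounded, and let $\nu:\mathbb R^d\setminus\{0\}\to[0,\infty)$ be measurable with $\nu(-h)=\nu(h)$, $\int_{\mathbb R^d}(1\wedge|h|^2)\,\nu(h)\,dh<\infty$ and $\int_{\mathbb R^d}\nu(h)\,dh=\infty$, such that the measure $\nu(h)\,dh$ has full support (it charges every nonempty open set). For an open set $D\subset\mathbb R^d$ let $H_\nu(D)$ be the space of $u\in L^2(D)$ with $$\|u\|_{H_\nu(D)}^2=\|u\|_{L^2(D)}^2+\iint_{D\times D}(u(x)-u(y))^2\nu(x-y)\,dx\,dy<\infty.$$ Assume that at least one of the following holds. - ($\mathscr A_1$) There are a map $E:H_\nu(\Omega)\to H_\nu(\mathbb R^d)$ and a constant $c>0$ with $Eu|_\Omega=u$ and $\|Eu\|_{H_\nu(\mathbb R^d)}\le c\,\|u\|_{H_\nu(\Omega)}$ for all $u\in H_\nu(\Omega)$. - ($\mathscr A_2$) $\partial\Omega$ is Lipschitz (locally, $\Omega$ is the region on one side of the graph of a Lipschitz function), $\nu$ is radial, and $\delta^{-2}\int_{B_\delta(0)}|h|^2\nu(h)\,dh\to\infty$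 as $\delta\to0^+$. - ($\mathscr A_3$) $\inf_{a\in\partial\Omega}\int_{\Omega_\delta}\nu(h-a)\,dh\to\infty$ as $\delta\to0^+$, where $\Omega_\delta=\{x\in\Omega:\operatorname{dist}(x,\partial\Omega)>\delta\}$. Let $V_\nu(\Omega|\mathbb R^d)$ be the space of measurable $u:\mathbb R^d\to\mathbb R$ (functions equal a.e. being identified) with $u|_\Omega\in L^2(\Omega)$ and $$\|u\|_{V_\nu(\Omega|\mathbb R^d)}^2=\|u\|_{L^2(\Omega)}^2+\iint_{\Omega\times\mathbb R^d}(u(x)-u(y))^2\nu(x-y)\,dx\,dy<\infty.$$ Fix a nonempty open set $B\subset\Omega$ and put $\widetilde\nu(x)=\int_B\big(1\wedge\nu(x-y)\big)\,dy$. Let $\Lambda\ge1$, and let $\beta:\Omega^c\to[0,\infty)$ be measurable such that $\beta\widetilde\nu^{-1}$ is essentially bounded on $\Omega^c$ and $|\Omega^c\cap\{\beta>0\}|>0$. Then there is a constant $C>0$, depending only on $d,\Omega,\Lambda,\nu,\beta$ and $B$, such that the following holds for every symmetric measurable $k:\mathbb R^d\times\mathbb R^d\setminus\operatorname{diag}\to[0,\infty)$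 with $\Lambda^{-1}\nu(y-x)\le k(x,y)\le\Lambda\nu(y-x)$ for all $x\ne y$, every $f\in L^2(\Omega)$ and every $g\in L^2(\Omega^c,\widetilde\nu^{-1})$. With $$Q_\beta(u,v)=\frac12\iint_{(\Omega^c\times\Omega^c)^c}(u(x)-u(y))(v(x)-v(y))\,k(x,y)\,dx\,dy+\int_{\Omega^c}u(y)v(y)\beta(y)\,dy,$$ there is a unique $u\in V_\nu(\Omega|\mathbb R^d)$ such that $$Q_\beta(u,v)=\int_\Omega f(x)v(x)\,dx+\int_{\Omega^c}g(y)v(y)\,dy\qquad\text{for all }v\in V_\nu(\Omega|\mathbb R^d),$$ and this $u$ satisfies $$\|u\|_{V_\nu(\Omega|\mathbb R^d)}\le C\big(\|f\|_{L^2(\Omega)}+\|g\|_{L^2(\Omega^c,\widetilde\nu^{-1})}\big).$$ -/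

import Mathlib

open MeasureTheory Filter Topology
open scoped NNReal ENNReal

noncomputable section

namespace NonlocalRobin

/-- The Euclidean space `ℝ^d`. -/
abbrev E (d : ℕ) : Type := EuclideanSpace ℝ (Fin d)

variable {d : ℕ}

/-! ### Lévy densities -/

/-- `ν` is the density of a symmetric Lévy measure: `ν` is (Lebesgue) measurable, symmetric and
`∫ (1 ∧ |h|²) ν(h) dh < ∞`. (The value `ν 0` never matters when `d ≥ 1`.) -/
structure IsSymmLevyDensity (ν : E d → ℝ≥0) : Prop where
  aemeasurable : AEMeasurable ν volume
  symm : ∀ h, ν (-h) = ν h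
  lintegral_lt_top : ∫⁻ h, min 1 (ENNReal.ofReal (‖h‖ ^ 2)) * (ν h : ℝ≥0∞) < ∞

/-- The measure `ν(h) dh` has full support: it charges every nonempty open set. -/
def HasFullSupport (ν : E d → ℝ≥0) : Prop :=
  (volume.withDensity fun h => (ν h : ℝ≥0∞)).IsOpenPosMeasure

/-- `ν` is radial, i.e. `ν h` depends only on `‖h‖`. -/
def IsRadial (ν : E d → ℝ≥0) : Prop :=
  ∀ h h' : E d, ‖h‖ = ‖h'‖ → ν h = ν h'

/-! ### Function spaces -/

/-- `∬_{A × B} (u(x) - u(y))² ν(x - y) dx dy`. -/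
def energy (ν : E d → ℝ≥0) (A B : Set (E d)) (u : E d → ℝ) : ℝ≥0∞ :=
  ∫⁻ p in A ×ˢ B, ENNReal.ofReal ((u p.1 - u p.2) ^ 2) * (ν (p.1 - p.2) : ℝ≥0∞)
    ∂(volume.prod volume)

/-- `u` (more precisely `u|_Ω`) belongs to `H_ν(Ω)`. -/
def MemH (ν : E d → ℝ≥0) (Ω : Set (E d)) (u : E d → ℝ) : Prop :=
  MemLp u 2 (volume.restrict Ω) ∧ energy ν Ω Ω u < ∞

/-- The norm of `H_ν(Ω)`. -/
def normH (ν : E d → ℝ≥0) (Ω : Set (E d)) (u : E d → ℝ) : ℝ :=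
  Real.sqrt ((eLpNorm u 2 (volume.restrict Ω)).toReal ^ 2 + (energy ν Ω Ω u).toReal)

/-- `u` belongs to `V_ν(Ω|ℝ^d)`: it is measurable on `ℝ^d`, `u|_Ω ∈ L²(Ω)` and
`∬_{Ω × ℝ^d} (u(x) - u(y))² ν(x - y) dx dy < ∞`. -/
structure MemV (ν : E d → ℝ≥0) (Ω : Set (E d)) (u : E d → ℝ) : Prop where
  aemeasurable : AEMeasurable u volume
  memLp : MemLp u 2 (volume.restrict Ω)
  energy_lt_top : energy ν Ω Set.univ u < ∞

/-- The norm of `V_ν(Ω|ℝ^d)`. -/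
def normV (ν : E d → ℝ≥0) (Ω : Set (E d)) (u : E d → ℝ) : ℝ :=
  Real.sqrt ((eLpNorm u 2 (volume.restrict Ω)).toReal ^ 2 + (energy ν Ω Set.univ u).toReal)

/-- The weight `ν̃(x) = ∫_B (1 ∧ ν(x - y)) dy`. -/
def nuTilde (ν : E d → ℝ≥0) (B : Set (E d)) (x : E d) : ℝ≥0∞ :=
  ∫⁻ y in B, min 1 (ν (x - y) : ℝ≥0∞)

/-- The measure `ν̃(y)⁻¹ dy` on `Ω^c`; its `L²` space is `L²(Ω^c, ν̃⁻¹)`. -/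
def invWeightMeasure (ν : E d → ℝ≥0) (B Ω : Set (E d)) : Measure (E d) :=
  (volume.restrict Ωᶜ).withDensity fun y => (nuTilde ν B y)⁻¹

/-! ### The classes of pairs `(ν, Ω)` -/

/-- `Ω` has Lipschitz boundary: near each boundary point, `Ω` is the region strictly above the
graph of a Lipschitz function over a hyperplane with unit normal `e`. Here `inner ℝ e x` is the
height of `x` and `x - inner ℝ e x • e` its projection to the hyperplane `e^⊥`; a Lipschitz
function on `e^⊥` is the same as the restriction to `e^⊥` of a Lipschitz function on `ℝ^d`. -/
def HasLipschitzBoundary (Ω : Set (E d)) : Prop :=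
  ∀ a ∈ frontier Ω, ∃ r > 0, ∃ e : E d, ‖e‖ = 1 ∧ ∃ (K : ℝ≥0) (γ : E d → ℝ),
    LipschitzWith K γ ∧
      ∀ x ∈ Metric.ball a r, x ∈ Ω ↔ γ (x - inner ℝ e x • e) < inner ℝ e x

/-- There is an extension operator `H_ν(Ω) → H_ν(ℝ^d)`. -/
def ClassA1 (ν : E d → ℝ≥0) (Ω : Set (E d)) : Prop :=
  ∃ (Ext : (E d → ℝ) → (E d → ℝ)) (C : ℝ), 0 < C ∧ ∀ u, MemH ν Ω u →
    MemH ν Set.univ (Ext u) ∧ Ext u =ᵐ[volume.restrict Ω] u ∧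
      normH ν Set.univ (Ext u) ≤ C * normH ν Ω u

/-- `q(δ) = δ⁻² ∫_{B_δ(0)} |h|² ν(h) dh`. -/
def q (ν : E d → ℝ≥0) (δ : ℝ) : ℝ≥0∞ :=
  ENNReal.ofReal ((δ ^ 2)⁻¹) *
    ∫⁻ h in Metric.ball (0 : E d) δ, ENNReal.ofReal (‖h‖ ^ 2) * (ν h : ℝ≥0∞)

/-- `∂Ω` is Lipschitz, `ν` is radial and `q(δ) → ∞` as `δ → 0+`. -/
def ClassA2 (ν : E d → ℝ≥0) (Ω : Set (E d)) : Prop :=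
  HasLipschitzBoundary Ω ∧ IsRadial ν ∧ Tendsto (q ν) (𝓝[>] 0) (𝓝 ∞)

/-- `q̃(δ) = inf_{a ∈ ∂Ω} ∫_{Ω_δ} ν(h - a) dh` with `Ω_δ = {x ∈ Ω : dist(x, ∂Ω) > δ}`. -/
def qTilde (ν : E d → ℝ≥0) (Ω : Set (E d)) (δ : ℝ) : ℝ≥0∞ :=
  ⨅ a ∈ frontier Ω, ∫⁻ h in {x ∈ Ω | δ < Metric.infDist x (frontier Ω)}, (ν (h - a) : ℝ≥0∞)

/-- `q̃(δ) → ∞` as `δ → 0+`. -/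
def ClassA3 (ν : E d → ℝ≥0) (Ω : Set (E d)) : Prop :=
  Tendsto (qTilde ν Ω) (𝓝[>] 0) (𝓝 ∞)

/-! ### The Robin problem -/

/-- `k` is a symmetric measurable kernel, comparable to `ν(y - x)` with constant `Λ`. -/
structure IsEllipticKernel (ν : E d → ℝ≥0) (Λ : ℝ) (k : E d → E d → ℝ≥0) : Prop where
  aemeasurable : AEMeasurable (fun p : E d × E d => k p.1 p.2) (volume.prod volume)
  symm : ∀ x y, k x y = k y x
  lower : ∀ x y, x ≠ y → Λ⁻¹ * (ν (y - x) : ℝ) ≤ (k x y : ℝ)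
  upper : ∀ x y, x ≠ y → (k x y : ℝ) ≤ Λ * (ν (y - x) : ℝ)

/-- `𝓔(u,v) = ½ ∬_{(Ω^c × Ω^c)^c} (u(x) - u(y)) (v(x) - v(y)) k(x,y) dx dy`. -/
def form (Ω : Set (E d)) (k : E d → E d → ℝ≥0) (u v : E d → ℝ) : ℝ :=
  (1 / 2) * ∫ p in (Ωᶜ ×ˢ Ωᶜ)ᶜ, (u p.1 - u p.2) * (v p.1 - v p.2) * (k p.1 p.2 : ℝ)
    ∂(volume.prod volume)

/-- `Q_β(u,v) = 𝓔(u,v) + ∫_{Ω^c} u v β`. -/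
def robinForm (Ω : Set (E d)) (k : E d → E d → ℝ≥0) (β : E d → ℝ) (u v : E d → ℝ) : ℝ :=
  form Ω k u v + ∫ y in Ωᶜ, u y * v y * β y

/-- `u ∈ V_ν(Ω|ℝ^d)` is a weak solution of the Robin problem `L u = f` in `Ω`,
`𝓝 u + β u = g` on `Ω^c`. -/
def IsWeakRobinSolution (ν : E d → ℝ≥0) (Ω : Set (E d)) (k : E d → E d → ℝ≥0)
    (β f g u : E d → ℝ) : Prop :=
  MemV ν Ω u ∧ ∀ v, MemV ν Ω v →
    robinForm Ω k β u v = (∫ x in Ω, f x * v x) + ∫ y in Ωᶜ, g y * v y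

end NonlocalRobin

end

noncomputable section

namespace NonlocalRobin

variable {d : ℕ}

/-! The problem is solved by Riesz representation for the form `Q_β`, once `Q_β` is coercive on
`V_ν(Ω|ℝ^d)` with a constant that sees `k` only through `Λ`.

Since `k` is comparable to `ν`, coercivity reduces to a Poincaré inequality
(`exists_poincare_robin`): the `L²(Ω)` norm is bounded by the energy plus `∫ u²β`. If it failed,
there would be functions of unit norm in `L²(Ω)` with right-hand sides tending to zero. Compactness
gives a limit in `L²(Ω)` of zero energy; full support of `ν` makes it a constant `c`
(`ae_eq_const_of_energy_eq_zero`). The trace inequality (`lintegral_sq_mul_nuTilde_le`) carries the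
convergence from `Ω` to `L²(ℝ^d, ν̃)`, where `β ≤ Mν̃` yields `c² ∫ β = 0`. As `β` is not null, `c =
0`, against the unit norm.

Compactness (`exists_subseq_cauchy`) rests on one property of a domain `D ⊇ Ω`: `∫_D ν(x - y) dy =
∞` for every `x` in the closure of `Ω`. Then some truncation `min ν n` has mass at least `K` in `D`
as seen from every point of `Ω`, so `K w(x)²` is bounded by the energy density of `w` plus the
square of a smoothing of `w`. Smoothing turns weak convergence into strong convergence, and `K` is
arbitrary. Under `ClassA1` one takes `D = ℝ^d` after extension; otherwise `D = Ω`, and the class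
assumption gives infinite mass at boundary points.

For solvability, `V_ν(Ω|ℝ^d)` is mapped to `L² × L²` by `energyMap`, whose inner product is `Q_β`.
Coercivity closes the range, bounds the right-hand side functional, and gives uniqueness a.e. on all
of `ℝ^d` because `ν̃ > 0` everywhere. -/

lemma sq_eLpNorm_two {α : Type*} [MeasurableSpace α] (μ : Measure α) (u : α → ℝ) :
    eLpNorm u 2 μ ^ 2 = ∫⁻ x, ENNReal.ofReal (u x ^ 2) ∂μ := by
  have h := eLpNorm_nnreal_pow_eq_lintegral (f := u) (μ := μ) (p := 2) (by norm_num)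
  have h2 : ((2 : ℝ≥0) : ℝ) = 2 := by norm_num
  have h3 : ((2 : ℝ≥0) : ℝ≥0∞) = 2 := by norm_num
  rw [h2, h3, ENNReal.rpow_two] at h
  rw [h]
  refine lintegral_congr fun x => ?_
  rw [ENNReal.rpow_two, Real.enorm_eq_ofReal_abs, ← ENNReal.ofReal_pow (abs_nonneg _), sq_abs]

lemma memLp_two_iff {α : Type*} [MeasurableSpace α] {μ : Measure α} {u : α → ℝ} :
    MemLp u 2 μ ↔ AEStronglyMeasurable u μ ∧ ∫⁻ x, ENNReal.ofReal (u x ^ 2) ∂μ < ∞ := by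
  rw [MemLp, ← sq_eLpNorm_two, ENNReal.pow_lt_top_iff]
  simp

lemma ofReal_add_sq_le (a b : ℝ) :
    ENNReal.ofReal ((a + b) ^ 2) ≤ 2 * ENNReal.ofReal (a ^ 2) + 2 * ENNReal.ofReal (b ^ 2) := by
  have h2 : (2 : ℝ≥0∞) = ENNReal.ofReal 2 := by simp
  rw [h2, ← ENNReal.ofReal_mul (by norm_num), ← ENNReal.ofReal_mul (by norm_num),
    ← ENNReal.ofReal_add (by positivity) (by positivity)]
  exact ENNReal.ofReal_le_ofReal (by nlinarith [sq_nonneg (a - b)])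

/-! ### Mass of a Lévy density near and away from the origin. -/

namespace IsSymmLevyDensity

variable {ν : E d → ℝ≥0} (hν : IsSymmLevyDensity ν)
include hν

lemma aemeasurable_coe : AEMeasurable (fun h => (ν h : ℝ≥0∞)) volume :=
  hν.aemeasurable.coe_nnreal_ennreal

lemma aemeasurable_sub :
    AEMeasurable (fun p : E d × E d => (ν (p.1 - p.2) : ℝ≥0∞)) (volume.prod volume) :=
  hν.aemeasurable_coe.comp_quasiMeasurePreserving
    (quasiMeasurePreserving_sub_of_right_invariant volume volume)

lemma sub_comm (x y : E d) : ν (x - y) = ν (y - x) := by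
  rw [← hν.symm, neg_sub]

/-- The cap `n` handles the unit ball; outside it `ν` equals the Lévy integrand. -/
lemma lintegral_min_lt_top (n : ℕ) : ∫⁻ h, min (n : ℝ≥0∞) (ν h) < ∞ := by
  have hle : ∀ h : E d, min (n : ℝ≥0∞) (ν h) ≤
      (Metric.ball (0 : E d) 1).indicator (fun _ => (n : ℝ≥0∞)) h +
        min 1 (ENNReal.ofReal (‖h‖ ^ 2)) * (ν h : ℝ≥0∞) := by
    intro h
    by_cases hh : h ∈ Metric.ball (0 : E d) 1
    · rw [Set.indicator_of_mem hh]
      exact (min_le_left _ _).trans le_self_add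
    · rw [Set.indicator_of_notMem hh, zero_add]
      have h1 : 1 ≤ ‖h‖ := by simpa using hh
      have : (1 : ℝ≥0∞) ≤ ENNReal.ofReal (‖h‖ ^ 2) := by
        rw [ENNReal.one_le_ofReal]; nlinarith
      rw [min_eq_left this, one_mul]
      exact min_le_right _ _
  refine (lintegral_mono hle).trans_lt ?_
  rw [lintegral_add_left (measurable_const.indicator Metric.isOpen_ball.measurableSet),
    lintegral_indicator Metric.isOpen_ball.measurableSet, lintegral_const]
  refine ENNReal.add_lt_top.2 ⟨ENNReal.mul_lt_top (by simp) ?_, hν.lintegral_lt_top⟩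
  rw [Measure.restrict_apply_univ]
  exact Metric.isBounded_ball.measure_lt_top

lemma lintegral_compl_ball_lt_top {r : ℝ} (hr : 0 < r) :
    ∫⁻ h in (Metric.ball (0 : E d) r)ᶜ, (ν h : ℝ≥0∞) < ∞ := by
  -- A positive lower bound for `1 ∧ |h|²` off the ball of radius `r`.
  set c : ℝ≥0∞ := min 1 (ENNReal.ofReal (r ^ 2)) with hc
  have hc0 : c ≠ 0 := by
    rw [hc]
    exact (lt_min one_pos (ENNReal.ofReal_pos.2 (by positivity))).ne'
  have hct : c ≠ ∞ := ((min_le_left _ _).trans_lt ENNReal.one_lt_top).ne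
  have h1 : c * ∫⁻ h in (Metric.ball (0 : E d) r)ᶜ, (ν h : ℝ≥0∞) < ∞ := by
    rw [← lintegral_const_mul' _ _ hct]
    refine lt_of_le_of_lt ?_ hν.lintegral_lt_top
    refine (setLIntegral_mono' Metric.isOpen_ball.measurableSet.compl fun h hh => ?_).trans
      (setLIntegral_le_lintegral (Metric.ball (0 : E d) r)ᶜ _)
    have h1 : r ≤ ‖h‖ := by simpa using hh
    rw [hc]
    gcongr
  exact (ENNReal.mul_lt_top_iff.1 h1).elim (fun h => h.2)
    (fun h => h.elim (fun h => (hc0 h).elim) (fun h => h ▸ ENNReal.zero_lt_top))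

/-- Off any ball the mass is finite, so the infinite mass concentrates at the origin. -/
lemma lintegral_ball_eq_top (hint : ∫⁻ h, (ν h : ℝ≥0∞) = ∞) {r : ℝ} (hr : 0 < r) :
    ∫⁻ h in Metric.ball (0 : E d) r, (ν h : ℝ≥0∞) = ∞ := by
  rw [← lintegral_add_compl _ (Metric.isOpen_ball (x := (0 : E d)) (ε := r)).measurableSet] at hint
  exact (ENNReal.add_eq_top.1 hint).resolve_right (hν.lintegral_compl_ball_lt_top hr).ne

lemma setLIntegral_sub_eq_top_of_ball (hint : ∫⁻ h, (ν h : ℝ≥0∞) = ∞) {x : E d} {r : ℝ}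
    (hr : 0 < r) {D : Set (E d)} (hD : MeasurableSet D) (hx : Metric.ball x r ⊆ D) :
    ∫⁻ y in D, (ν (x - y) : ℝ≥0∞) = ∞ := by
  rw [eq_top_iff, ← hν.lintegral_ball_eq_top hint hr, ← lintegral_indicator hD,
    ← lintegral_indicator Metric.isOpen_ball.measurableSet,
    ← lintegral_sub_left_eq_self (fun y => D.indicator (fun y => (ν (x - y) : ℝ≥0∞)) y) x]
  refine lintegral_mono fun h => ?_
  by_cases hh : h ∈ Metric.ball (0 : E d) r
  · rw [Set.indicator_of_mem hh, Set.indicator_of_mem, sub_sub_cancel]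
    apply hx
    simpa [dist_eq_norm] using hh
  · rw [Set.indicator_of_notMem hh]
    exact zero_le

end IsSymmLevyDensity

/-! ### Infinite mass of `ν` in `Ω` seen from the boundary. -/

/-- A radial density that is not integrable at the origin is not integrable on any open cone. -/
lemma lintegral_cone_eq_top {ν : E d → ℝ≥0} (hrad : IsRadial ν) (hd : 1 ≤ d) {r : ℝ}
    (hν : ∫⁻ h in Metric.ball (0 : E d) r, (ν h : ℝ≥0∞) = ∞) {e : E d} (he : ‖e‖ = 1) (K : ℝ≥0) :
    ∫⁻ h in {h : E d | K * ‖h - (inner ℝ e h : ℝ) • e‖ < inner ℝ e h} ∩ Metric.ball 0 r,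
      (ν h : ℝ≥0∞) = ∞ := by
  set cone : E d → Set (E d) := fun e => {h : E d | K * ‖h - (inner ℝ e h : ℝ) • e‖ < inner ℝ e h}
    with hcone
  have hopen : ∀ e, IsOpen (cone e) := fun e => isOpen_lt (by fun_prop) (by fun_prop)
  by_contra hne
  have hsph : ∀ e' ∈ Metric.sphere (0 : E d) 1,
      ∫⁻ h in cone e' ∩ Metric.ball 0 r, (ν h : ℝ≥0∞) ≠ ∞ := by
    intro e' he'
    have he' : ‖e'‖ = 1 := by simpa using he'
    -- This reflection exchanges `e'` and `e`. It preserves volume and `ν`, so all cones of this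
    -- aperture carry the same mass as the one assumed finite.
    set R : E d ≃ₗᵢ[ℝ] E d := (ℝ ∙ (e' - e))ᗮ.reflection
    have hR : R e' = e := Submodule.reflection_sub (by rw [he, he'])
    have hmp : MeasurePreserving R volume volume := R.measurePreserving
    have hpre : R ⁻¹' (cone e ∩ Metric.ball 0 r) = cone e' ∩ Metric.ball 0 r := by
      ext h
      have hin : inner ℝ e (R h) = inner ℝ e' h := by rw [← hR, R.inner_map_map]
      have hn : ‖R h - (inner ℝ e' h : ℝ) • e‖ = ‖h - (inner ℝ e' h : ℝ) • e'‖ := by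
        rw [← R.norm_map (h - _), map_sub, map_smul, hR]
      simp [hcone, hin, hn]
    rw [← hpre]
    have := hmp.setLIntegral_comp_preimage_emb (R.toHomeomorph.measurableEmbedding)
      (fun h => (ν h : ℝ≥0∞)) (cone e ∩ Metric.ball 0 r)
    have h2 : ∀ h, ν (R h) = ν h := fun h => hrad _ _ (R.norm_map h)
    simp only [h2] at this
    rw [this]
    exact hne
  -- Each cone is an open neighbourhood of its axis vector. Finitely many cover the sphere, hence by
  -- homogeneity the punctured ball, which would then have finite mass.
  obtain ⟨t, ht, hcov⟩ := (isCompact_sphere (0 : E d) 1).elim_nhds_subcover cone (by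
    intro e' he'
    have he' : ‖e'‖ = 1 := by simpa using he'
    refine (hopen e').mem_nhds ?_
    simp [hcone, he'])
  have hcover : Metric.ball (0 : E d) r ⊆ {0} ∪ ⋃ e' ∈ t, cone e' ∩ Metric.ball 0 r := by
    intro h hh
    rcases eq_or_ne h 0 with rfl | h0
    · simp
    right
    have hpos : 0 < ‖h‖ := norm_pos_iff.2 h0
    have hmem : ‖h‖⁻¹ • h ∈ Metric.sphere (0 : E d) 1 := by
      simp [norm_smul, hpos.ne']
    obtain ⟨e', he't, he'⟩ := Set.mem_iUnion₂.1 (hcov hmem)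
    refine Set.mem_iUnion₂.2 ⟨e', he't, ?_, hh⟩
    simp only [hcone, Set.mem_ofPred_eq, inner_smul_right] at he' ⊢
    rw [mul_smul, ← smul_sub, norm_smul, norm_inv, norm_norm] at he'
    have := mul_lt_mul_of_pos_left he' hpos
    field_simp at this
    linarith
  have : Nonempty (Fin d) := ⟨⟨0, hd⟩⟩
  have hlt : ∫⁻ h in Metric.ball (0 : E d) r, (ν h : ℝ≥0∞) < ∞ := by
    refine (lintegral_mono_set hcover).trans_lt ((lintegral_union_le _ _ _).trans_lt ?_)
    rw [setLIntegral_measure_zero _ _ (measure_singleton 0), zero_add]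
    have hU : ⋃ e' ∈ t, cone e' ∩ Metric.ball 0 r =
        ⋃ e' : t, cone e' ∩ Metric.ball (0 : E d) r := by
      rw [Set.iUnion_subtype]
    rw [hU]
    refine (lintegral_iUnion_le _ _).trans_lt ?_
    rw [tsum_fintype]
    exact ENNReal.sum_lt_top.2 fun e' _ => (hsph e' (ht e' e'.2)).lt_top
  exact hlt.ne hν

lemma setLIntegral_comp_sub_left {D : Set (E d)} (hD : MeasurableSet D) (f : E d → ℝ≥0∞)
    (x : E d) : ∫⁻ y in D, f (x - y) = ∫⁻ h, {h | x - h ∈ D}.indicator f h := by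
  rw [← lintegral_indicator hD, ← lintegral_sub_left_eq_self _ x]
  refine lintegral_congr fun h => ?_
  by_cases hh : x - h ∈ D
  · rw [Set.indicator_of_mem hh, Set.indicator_of_mem (show h ∈ {h | x - h ∈ D} from hh),
      sub_sub_cancel]
  · rw [Set.indicator_of_notMem hh, Set.indicator_of_notMem (show h ∉ {h | x - h ∈ D} from hh)]

/-- A Lipschitz graph leaves a truncated open cone with vertex `a` inside `Ω`, and a radial `ν` of
infinite mass at the origin has infinite mass on every such cone. -/
lemma ClassA2.lintegral_eq_top {ν : E d → ℝ≥0} {Ω : Set (E d)} (h : ClassA2 ν Ω) (hd : 1 ≤ d)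
    (hΩ : IsOpen Ω) (hν : IsSymmLevyDensity ν) (hint : ∫⁻ h, (ν h : ℝ≥0∞) = ∞) {a : E d}
    (ha : a ∈ frontier Ω) : ∫⁻ y in Ω, (ν (a - y) : ℝ≥0∞) = ∞ := by
  obtain ⟨hlip, hrad, -⟩ := h
  obtain ⟨r, hr, e, he, K, γ, hγ, hgraph⟩ := hlip a ha
  -- A boundary point strictly below the graph would have a neighbourhood disjoint from `Ω`.
  have hle : γ (a - (inner ℝ e a : ℝ) • e) ≤ inner ℝ e a := by
    by_contra! hlt
    have hcont : Continuous fun x : E d => γ (x - (inner ℝ e x : ℝ) • e) :=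
      hγ.continuous.comp (by fun_prop)
    have hev : ∀ᶠ x in 𝓝 a, (inner ℝ e x : ℝ) < γ (x - (inner ℝ e x : ℝ) • e) :=
      (isOpen_lt (by fun_prop) hcont).mem_nhds hlt
    have hfr := mem_closure_iff_frequently.1 (frontier_subset_closure ha)
    obtain ⟨x, hx, hx1, hx2⟩ :=
      (hfr.and_eventually (hev.and (Metric.ball_mem_nhds a hr))).exists
    exact lt_asymm hx1 ((hgraph x hx2).1 hx)
  rw [eq_top_iff, ← lintegral_cone_eq_top hrad hd (hν.lintegral_ball_eq_top hint hr) he K,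
    ← lintegral_indicator hΩ.measurableSet, ← lintegral_indicator
      (((isOpen_lt (by fun_prop) (by fun_prop)).inter Metric.isOpen_ball).measurableSet),
    ← lintegral_add_left_eq_self (fun y => Ω.indicator (fun y => (ν (a - y) : ℝ≥0∞)) y) a]
  refine lintegral_mono fun h => ?_
  by_cases hh : h ∈ {h : E d | K * ‖h - (inner ℝ e h : ℝ) • e‖ < inner ℝ e h} ∩ Metric.ball 0 r
  swap
  · rw [Set.indicator_of_notMem hh]
    exact bot_le
  rw [Set.indicator_of_mem hh]
  obtain ⟨hh1, hh2⟩ := hh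
  have hmem : a + h ∈ Ω := by
    rw [hgraph _ (by simpa using hh2)]
    have := hγ.dist_le_mul (a + h - (inner ℝ e (a + h) : ℝ) • e) (a - (inner ℝ e a : ℝ) • e)
    have h3 : a + h - (inner ℝ e (a + h) : ℝ) • e - (a - (inner ℝ e a : ℝ) • e) =
        h - (inner ℝ e h : ℝ) • e := by
      rw [inner_add_right, add_smul]; abel
    rw [Real.dist_eq, dist_eq_norm, h3] at this
    have h4 := (abs_le.1 this).2
    have hh1 : K * ‖h - (inner ℝ e h : ℝ) • e‖ < inner ℝ e h := hh1
    rw [inner_add_right] at h4 ⊢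
    linarith
  rw [Set.indicator_of_mem hmem]
  simp [hν.symm]

/-- For every `δ` the integral dominates `qTilde ν Ω δ`, because `Ω_δ ⊆ Ω`. -/
lemma ClassA3.lintegral_eq_top {ν : E d → ℝ≥0} {Ω : Set (E d)} (h : ClassA3 ν Ω)
    (hν : IsSymmLevyDensity ν) {a : E d}
    (ha : a ∈ frontier Ω) : ∫⁻ y in Ω, (ν (a - y) : ℝ≥0∞) = ∞ := by
  refine eq_top_iff.2 (le_of_tendsto h (Eventually.of_forall fun δ => ?_))
  refine (iInf₂_le a ha).trans ?_
  simp only [hν.sub_comm a]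
  exact lintegral_mono_set fun x hx => hx.1

/-- If `∫_D ν(x - y) dy = ∞` for all `x` in the closure of a bounded set `Ω`, then the integrals of
the truncated density are uniformly large on `Ω`. -/
lemma exists_truncation_lintegral_ge {ν : E d → ℝ≥0} (hν : IsSymmLevyDensity ν)
    {Ω D : Set (E d)} (hΩ : Bornology.IsBounded Ω) (hD : IsOpen D)
    (htop : ∀ x ∈ closure Ω, ∫⁻ y in D, (ν (x - y) : ℝ≥0∞) = ∞) (K : ℝ≥0) :
    ∃ n : ℕ, ∀ x ∈ Ω, (K : ℝ≥0∞) ≤ ∫⁻ y in D, min (n : ℝ≥0∞) (ν (x - y)) := by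
  -- Take a bad point for each truncation level `n`. A subsequence converges to some `a` in the
  -- closure of `Ω`, and Fatou's lemma bounds the infinite mass at `a` by `K`.
  by_contra! hcon
  choose x hxΩ hx using hcon
  obtain ⟨a, ha, φ, hφ, hlim⟩ := hΩ.isCompact_closure.tendsto_subseq
    (fun n => subset_closure (hxΩ n))
  set F : E d → ℕ → E d → ℝ≥0∞ := fun x n h =>
    {h | x - h ∈ D}.indicator (fun h => min (n : ℝ≥0∞) (ν h)) h with hF
  have hFint : ∀ x n, ∫⁻ h, F x n h = ∫⁻ y in D, min (n : ℝ≥0∞) (ν (x - y)) := by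
    intro x n
    rw [setLIntegral_comp_sub_left hD.measurableSet (fun h => min (n : ℝ≥0∞) (ν h))]
  have hFmeas : ∀ x n, AEMeasurable (F x n) volume := fun x n =>
    (aemeasurable_const.min hν.aemeasurable_coe).indicator
      ((hD.preimage (by fun_prop : Continuous fun h : E d => x - h)).measurableSet)
  have hFatou := lintegral_liminf_le' (μ := volume) (u := atTop)
    (f := fun k => F (x (φ k)) (φ k))
    (fun k => hFmeas _ _)
  have hle : ∫⁻ y in D, (ν (a - y) : ℝ≥0∞) ≤
      ∫⁻ h, liminf (fun k => F (x (φ k)) (φ k) h) atTop := by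
    rw [setLIntegral_comp_sub_left hD.measurableSet (fun h => (ν h : ℝ≥0∞))]
    refine lintegral_mono fun h => ?_
    by_cases hh : h ∈ {h | a - h ∈ D}
    swap
    · rw [Set.indicator_of_notMem hh]
      exact bot_le
    rw [Set.indicator_of_mem hh]
    have hh : a - h ∈ D := hh
    -- For fixed `h`, openness of `D` keeps `x (φ k) - h` in `D` eventually, and the truncation at
    -- `φ k` eventually exceeds `ν h`.
    refine le_liminf_of_le (by isBoundedDefault) ?_
    have h1 : ∀ᶠ k in atTop, x (φ k) - h ∈ D :=
      (hlim.sub_const h).eventually (hD.mem_nhds hh)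
    obtain ⟨N, hN⟩ := exists_nat_ge (ν h)
    filter_upwards [h1, eventually_ge_atTop N] with k hk hkN
    have : (ν h : ℝ≥0∞) ≤ (φ k : ℝ≥0∞) := by
      exact_mod_cast hN.trans (by exact_mod_cast hkN.trans (hφ.id_le k))
    simp [hF, hk, this]
  rw [htop a ha] at hle
  have h2 : liminf (fun k => ∫⁻ h, F (x (φ k)) (φ k) h) atTop ≤ K := by
    refine liminf_le_of_frequently_le' (Frequently.of_forall fun k => ?_)
    rw [hFint]
    exact (hx _).le
  exact ENNReal.coe_ne_top (top_le_iff.1 (hle.trans (hFatou.trans h2)))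

/-! ### The energy as an iterated integral. -/

lemma aemeasurable_energy {ν : E d → ℝ≥0} (hν : IsSymmLevyDensity ν) {A B : Set (E d)}
    {u : E d → ℝ} (hA : AEMeasurable u (volume.restrict A))
    (hB : AEMeasurable u (volume.restrict B)) :
    AEMeasurable (fun p : E d × E d => ENNReal.ofReal ((u p.1 - u p.2) ^ 2) *
      (ν (p.1 - p.2) : ℝ≥0∞)) ((volume.restrict A).prod (volume.restrict B)) := by
  have h1 := hA.comp_quasiMeasurePreserving
    (Measure.quasiMeasurePreserving_fst (ν := volume.restrict B))
  have h2 := hB.comp_quasiMeasurePreserving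
    (Measure.quasiMeasurePreserving_snd (μ := volume.restrict A))
  have h3 : AEMeasurable (fun p : E d × E d => (ν (p.1 - p.2) : ℝ≥0∞))
      ((volume.restrict A).prod (volume.restrict B)) := by
    rw [Measure.prod_restrict]
    exact hν.aemeasurable_sub.restrict
  exact ((h1.sub h2).pow_const 2).ennreal_ofReal.mul h3

lemma energy_eq_lintegral {ν : E d → ℝ≥0} (hν : IsSymmLevyDensity ν) {A B : Set (E d)}
    {u : E d → ℝ} (hA : AEMeasurable u (volume.restrict A))
    (hB : AEMeasurable u (volume.restrict B)) :
    energy ν A B u = ∫⁻ x in A, ∫⁻ y in B,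
      ENNReal.ofReal ((u x - u y) ^ 2) * (ν (x - y) : ℝ≥0∞) := by
  rw [energy, ← Measure.prod_restrict, lintegral_prod _ (aemeasurable_energy hν hA hB)]

lemma energy_mono {ν : E d → ℝ≥0} {A A' B B' : Set (E d)} (hA : A ⊆ A') (hB : B ⊆ B')
    (u : E d → ℝ) : energy ν A B u ≤ energy ν A' B' u :=
  lintegral_mono_set (Set.prod_mono hA hB)

lemma ae_prod_of_ae_fst {P : E d → Prop} (h : ∀ᵐ x, P x) :
    ∀ᵐ p : E d × E d ∂(volume.prod volume), P p.1 :=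
  Measure.quasiMeasurePreserving_fst.ae h

lemma ae_prod_of_ae_snd {P : E d → Prop} (h : ∀ᵐ x, P x) :
    ∀ᵐ p : E d × E d ∂(volume.prod volume), P p.2 :=
  Measure.quasiMeasurePreserving_snd.ae h

/-! ### The weight `ν̃` and the trace inequality. -/

section nuTilde

variable {ν : E d → ℝ≥0} (hν : IsSymmLevyDensity ν) {B : Set (E d)}
include hν

lemma aemeasurable_min_sub :
    AEMeasurable (fun p : E d × E d => min 1 (ν (p.1 - p.2) : ℝ≥0∞)) (volume.prod volume) :=
  aemeasurable_const.min hν.aemeasurable_sub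

lemma aemeasurable_nuTilde : AEMeasurable (nuTilde ν B) volume := by
  have h : AEMeasurable (fun p : E d × E d => min 1 (ν (p.1 - p.2) : ℝ≥0∞))
      (volume.prod (volume.restrict B)) := by
    refine (aemeasurable_min_sub hν).mono_ac ?_
    exact Measure.AbsolutelyContinuous.rfl.prod Measure.restrict_le_self.absolutelyContinuous
  exact h.lintegral_prod_right'

lemma nuTilde_lt_top (x : E d) : nuTilde ν B x < ∞ := by
  refine lt_of_le_of_lt (setLIntegral_le_lintegral _ _) ?_
  rw [lintegral_sub_left_eq_self (fun h => min 1 (ν h : ℝ≥0∞)) x]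
  simpa using hν.lintegral_min_lt_top 1

/-- `1 ∧ ν` vanishes exactly where `ν` does, and the translates `x - B` are nonempty and open, so
full support applies. -/
lemma nuTilde_pos (hsupp : HasFullSupport ν) (hB : IsOpen B) (hne : B.Nonempty) (x : E d) :
    0 < nuTilde ν B x := by
  rw [pos_iff_ne_zero]
  intro h0
  have hO : IsOpen {h : E d | x - h ∈ B} := hB.preimage (by fun_prop : Continuous fun h => x - h)
  rw [nuTilde, setLIntegral_comp_sub_left hB.measurableSet (fun h => min 1 (ν h : ℝ≥0∞)),
    lintegral_indicator hO.measurableSet,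
    lintegral_eq_zero_iff' (aemeasurable_const.min hν.aemeasurable_coe).restrict] at h0
  have hsupp : (volume.withDensity fun h => (ν h : ℝ≥0∞)).IsOpenPosMeasure := hsupp
  obtain ⟨y, hy⟩ := hne
  refine hO.measure_ne_zero (volume.withDensity fun h => (ν h : ℝ≥0∞))
    ⟨x - y, by simpa using hy⟩ ?_
  rw [withDensity_apply _ hO.measurableSet, lintegral_eq_zero_iff' hν.aemeasurable_coe.restrict]
  filter_upwards [h0] with h hh
  simpa [min_eq_zero] using hh

/-- The trace inequality: `L²(ℝ^d, ν̃)` is controlled by the energy and the `L²` norm on `B`. -/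
lemma lintegral_sq_mul_nuTilde_le {w : E d → ℝ} (hw : AEMeasurable w volume) :
    ∫⁻ y, ENNReal.ofReal (w y ^ 2) * nuTilde ν B y ≤
      2 * energy ν B Set.univ w +
        2 * (∫⁻ h, min 1 (ν h : ℝ≥0∞)) * ∫⁻ x in B, ENNReal.ofReal (w x ^ 2) := by
  set G : E d × E d → ℝ≥0∞ := fun p =>
    ENNReal.ofReal ((w p.1 - w p.2) ^ 2) * (ν (p.1 - p.2) : ℝ≥0∞) with hG
  set H : E d × E d → ℝ≥0∞ := fun p =>
    ENNReal.ofReal (w p.1 ^ 2) * min 1 (ν (p.1 - p.2) : ℝ≥0∞) with hH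
  have hac : (volume.restrict B).prod (volume : Measure (E d)) ≪ volume.prod volume :=
    Measure.restrict_le_self.absolutelyContinuous.prod Measure.AbsolutelyContinuous.rfl
  have hGm : AEMeasurable G ((volume.restrict B).prod volume) := by
    have := aemeasurable_energy hν (A := B) (B := Set.univ) hw.restrict hw.restrict
    rwa [Measure.restrict_univ] at this
  have hHm : AEMeasurable H ((volume.restrict B).prod volume) :=
    (((hw.restrict.comp_quasiMeasurePreserving
      Measure.quasiMeasurePreserving_fst).pow_const 2).ennreal_ofReal).mul
      ((aemeasurable_min_sub hν).mono_ac hac)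
  -- Split `w y = (w y - w x) + w x` and average over `x ∈ B` with weight `1 ∧ ν`: the difference
  -- gives the energy, the rest the `L²(B)` norm.
  have h1 : ∀ y, ENNReal.ofReal (w y ^ 2) * nuTilde ν B y ≤
      ∫⁻ x in B, (2 * G (x, y) + 2 * H (x, y)) := by
    intro y
    rw [nuTilde, ← lintegral_const_mul' _ _ ENNReal.ofReal_ne_top]
    refine lintegral_mono fun x => ?_
    simp only [hG, hH, hν.sub_comm y x]
    have h2 := ofReal_add_sq_le (w y - w x) (w x)
    rw [sub_add_cancel] at h2
    calc _ ≤ (2 * ENNReal.ofReal ((w y - w x) ^ 2) + 2 * ENNReal.ofReal (w x ^ 2)) *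
          min 1 (ν (x - y) : ℝ≥0∞) := by gcongr
      _ = 2 * ENNReal.ofReal ((w x - w y) ^ 2) * min 1 (ν (x - y) : ℝ≥0∞) +
          2 * ENNReal.ofReal (w x ^ 2) * min 1 (ν (x - y) : ℝ≥0∞) := by
        rw [add_mul, ← neg_sub (w x), neg_sq]
      _ ≤ _ := by
        simp only [mul_assoc]
        gcongr
        exact min_le_right _ _
  have hE : energy ν B Set.univ w = ∫⁻ p, G p ∂((volume.restrict B).prod volume) := by
    rw [energy, ← Measure.prod_restrict, Measure.restrict_univ]
  have hH2 : ∫⁻ p, H p ∂((volume.restrict B).prod volume) =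
      (∫⁻ h, min 1 (ν h : ℝ≥0∞)) * ∫⁻ x in B, ENNReal.ofReal (w x ^ 2) := by
    rw [lintegral_prod _ hHm, mul_comm, ← lintegral_mul_const'' _
      (hw.restrict.pow_const 2).ennreal_ofReal]
    refine lintegral_congr fun x => ?_
    simp only [hH]
    rw [lintegral_const_mul' _ _ ENNReal.ofReal_ne_top,
      lintegral_sub_left_eq_self (fun h => min 1 (ν h : ℝ≥0∞)) x]
  refine (lintegral_mono h1).trans ?_
  rw [← lintegral_prod_symm (fun p => 2 * G p + 2 * H p)
    ((hGm.const_mul 2).add (hHm.const_mul 2)), lintegral_add_left' (hGm.const_mul 2),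
    lintegral_const_mul'' _ hGm, lintegral_const_mul'' _ hHm, hE, hH2, mul_assoc]

end nuTilde

/-! ### Functions of zero energy are constant. -/

open scoped Pointwise in
/-- Two sets of positive measure have translates overlapping in positive measure, for an open set
of translations. -/
lemma exists_isOpen_forall_measure_inter_pos {A A' : Set (E d)} (hA : MeasurableSet A)
    (hA' : MeasurableSet A') (hA0 : volume A ≠ 0) (hA'0 : volume A' ≠ 0) :
    ∃ U : Set (E d), IsOpen U ∧ U.Nonempty ∧
      ∀ h ∈ U, volume (A ∩ (fun x => x - h) ⁻¹' A') ≠ 0 := by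
  -- By Fubini the overlap volume integrates over all translations to `|A| |A'|`, which is not zero.
  have h1 : ∃ h0 : E d, volume (A ∩ (fun x => x - h0) ⁻¹' A') ≠ 0 := by
    by_contra! hcon
    have hm : MeasurableSet {p : E d × E d | p.1 ∈ A ∧ p.1 - p.2 ∈ A'} :=
      (measurable_fst hA).inter ((measurable_fst.sub measurable_snd) hA')
    have hz : (volume.prod volume) {p : E d × E d | p.1 ∈ A ∧ p.1 - p.2 ∈ A'} = 0 := by
      rw [Measure.prod_apply_symm hm]
      exact (lintegral_congr hcon).trans lintegral_zero
    rw [Measure.prod_apply hm] at hz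
    have h2 : ∀ x, volume (Prod.mk x ⁻¹' {p : E d × E d | p.1 ∈ A ∧ p.1 - p.2 ∈ A'}) =
        A.indicator (fun _ => volume A') x := by
      intro x
      by_cases hx : x ∈ A
      · rw [Set.indicator_of_mem hx, ← (Measure.measurePreserving_sub_left volume
          x).measure_preimage hA'.nullMeasurableSet]
        congr 1
        ext h
        simp [hx]
      · rw [Set.indicator_of_notMem hx]
        simp [hx]
    simp only [h2] at hz
    rw [lintegral_indicator hA, lintegral_const, Measure.restrict_apply_univ] at hz
    exact (mul_ne_zero hA'0 hA0) hz
  obtain ⟨h0, hh0⟩ := h1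
  have hAm : MeasurableSet (A ∩ (fun x => x - h0) ⁻¹' A') :=
    hA.inter ((measurable_id.sub_const h0) hA')
  -- Translation is continuous in measure on a compact `k` inside the overlap: for `h` near `h0` the
  -- set `k` and its translate by `h - h0` still meet in positive measure.
  obtain ⟨k, hk, hkc, hkpos⟩ := hAm.exists_lt_isCompact (pos_iff_ne_zero.2 hh0)
  have hlim := tendsto_measure_vadd_sdiff_isCompact_isClosed (μ := (volume : Measure (E d))) hkc
    hkc.isClosed
  obtain ⟨V, hV, hVo, h0V⟩ := eventually_nhds_iff.1 (hlim.eventually_lt_const hkpos)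
  refine ⟨(fun h => h - h0) ⁻¹' V, hVo.preimage (by fun_prop), ⟨h0, by simpa using h0V⟩, ?_⟩
  intro h hh
  have hlt : volume (((h - h0) +ᵥ k) \ k) < volume k := hV _ hh
  have hpos : volume (((h - h0) +ᵥ k) ∩ k) ≠ 0 := by
    intro hz
    have h3 := measure_inter_add_sdiff (μ := volume) ((h - h0) +ᵥ k) hkc.measurableSet
    rw [hz, zero_add, measure_vadd] at h3
    exact hlt.ne h3
  refine fun hz => hpos (measure_mono_null ?_ hz)
  rintro z ⟨hz1, hz2⟩
  obtain ⟨y, hy, rfl⟩ := hz1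
  refine ⟨(hk hz2).1, ?_⟩
  have hy' := (hk hy).2
  simp only [Set.mem_preimage, vadd_eq_add] at hy' ⊢
  convert hy' using 1
  abel

/-- A function of zero energy on a measurable set is a.e. constant there, if `ν` has full
support. -/
lemma ae_eq_const_of_energy_eq_zero {ν : E d → ℝ≥0} (hν : IsSymmLevyDensity ν)
    (hsupp : HasFullSupport ν) {Ω : Set (E d)} (hΩ : MeasurableSet Ω) {u : E d → ℝ}
    (hu : AEMeasurable u (volume.restrict Ω)) (h0 : energy ν Ω Ω u = 0) :
    ∃ c : ℝ, u =ᵐ[volume.restrict Ω] fun _ => c := by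
  -- It suffices that no measurable `S` splits `Ω` into two sets of positive measure according to
  -- whether `u ∈ S`.
  refine exists_eventuallyEq_const_of_forall_separating MeasurableSet fun S hS => ?_
  obtain ⟨u', hu'm, huu'⟩ := id hu
  by_contra! hcon
  obtain ⟨hc1, hc2⟩ := hcon
  set A := Ω ∩ u' ⁻¹' S with hAdef
  set A' := Ω ∩ u' ⁻¹' Sᶜ with hA'def
  have hA : MeasurableSet A := hΩ.inter (hu'm hS)
  have hA' : MeasurableSet A' := hΩ.inter (hu'm hS.compl)
  have hA0 : volume A ≠ 0 := by
    intro hz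
    refine hc2 ?_
    have : ∀ᵐ x ∂(volume.restrict Ω), x ∉ A := ae_restrict_of_ae (measure_eq_zero_iff_ae_notMem.1 hz)
    filter_upwards [this, huu', ae_restrict_mem hΩ] with x hx1 hx2 hx3 hx4
    exact hx1 ⟨hx3, by rw [Set.mem_preimage, ← hx2]; exact hx4⟩
  have hA'0 : volume A' ≠ 0 := by
    intro hz
    refine hc1 ?_
    have : ∀ᵐ x ∂(volume.restrict Ω), x ∉ A' :=
      ae_restrict_of_ae (measure_eq_zero_iff_ae_notMem.1 hz)
    filter_upwards [this, huu', ae_restrict_mem hΩ] with x hx1 hx2 hx3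
    by_contra hx4
    exact hx1 ⟨hx3, by rw [Set.mem_preimage, ← hx2]; exact hx4⟩
  obtain ⟨U, hU, hUne, hUpos⟩ := exists_isOpen_forall_measure_inter_pos hA hA' hA0 hA'0
  rw [energy, ← Measure.prod_restrict, lintegral_eq_zero_iff' (aemeasurable_energy hν hu hu)] at h0
  have hF0 : ∀ᵐ p : E d × E d ∂(volume.prod volume),
      A.indicator (1 : E d → ℝ≥0∞) p.1 * A'.indicator 1 p.2 * (ν (p.1 - p.2) : ℝ≥0∞) = 0 := by
    have hq1 := (Measure.quasiMeasurePreserving_fst (μ := volume.restrict Ω)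
      (ν := volume.restrict Ω)).ae huu'
    have hq2 := (Measure.quasiMeasurePreserving_snd (μ := volume.restrict Ω)
      (ν := volume.restrict Ω)).ae huu'
    have hall := h0.and (hq1.and hq2)
    rw [Measure.prod_restrict] at hall
    have hall := (ae_restrict_iff' (hΩ.prod hΩ)).1 hall
    filter_upwards [hall] with p hp
    by_cases h1 : p.1 ∈ A
    swap
    · simp [h1]
    by_cases h2 : p.2 ∈ A'
    swap
    · simp [h2]
    obtain ⟨hp1, hp2, hp3⟩ := hp ⟨h1.1, h2.1⟩
    have hne : u p.1 - u p.2 ≠ 0 := by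
      intro heq
      have h3 := h1.2
      have h4 := h2.2
      simp only [Set.mem_preimage, Set.mem_compl_iff] at h3 h4
      rw [← hp3, ← sub_eq_zero.1 heq, hp2] at h4
      exact h4 h3
    have : ENNReal.ofReal ((u p.1 - u p.2) ^ 2) ≠ 0 :=
      (ENNReal.ofReal_pos.2 (by positivity)).ne'
    rw [(mul_eq_zero.1 hp1).resolve_left this, mul_zero]
  have hFm : AEMeasurable (fun p : E d × E d =>
      A.indicator (1 : E d → ℝ≥0∞) p.1 * A'.indicator 1 p.2 * (ν (p.1 - p.2) : ℝ≥0∞))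
      (volume.prod volume) :=
    ((((measurable_one.indicator hA).comp measurable_fst).mul
      ((measurable_one.indicator hA').comp measurable_snd)).aemeasurable).mul hν.aemeasurable_sub
  have hI : ∫⁻ x, ∫⁻ y, A.indicator (1 : E d → ℝ≥0∞) x * A'.indicator 1 y *
      (ν (x - y) : ℝ≥0∞) = 0 := by
    rw [← lintegral_prod _ hFm]
    exact (lintegral_congr_ae hF0).trans lintegral_zero
  -- Substituting `h = x - y` makes the overlap volume of `A` and `A' + h` appear as the coefficient
  -- of `ν h`; its positivity on `U` forces `ν = 0` a.e. there.
  have hI2 : ∫⁻ h, ∫⁻ x, A.indicator (1 : E d → ℝ≥0∞) x * A'.indicator 1 (x - h) *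
      (ν h : ℝ≥0∞) = 0 := by
    rw [lintegral_lintegral_swap, ← hI]
    · refine lintegral_congr fun x => ?_
      rw [← lintegral_sub_left_eq_self _ x]
      simp
    · exact ((((measurable_one.indicator hA).comp measurable_snd).mul
        ((measurable_one.indicator hA').comp
          (measurable_snd.sub measurable_fst))).aemeasurable).mul
        (hν.aemeasurable_coe.comp_quasiMeasurePreserving Measure.quasiMeasurePreserving_fst)
  have hI3 : ∀ h, ∫⁻ x, A.indicator (1 : E d → ℝ≥0∞) x * A'.indicator 1 (x - h) *
      (ν h : ℝ≥0∞) = volume (A ∩ (fun x => x - h) ⁻¹' A') * ν h := by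
    intro h
    have hm : MeasurableSet (A ∩ (fun x => x - h) ⁻¹' A') :=
      hA.inter ((measurable_id.sub_const h) hA')
    rw [lintegral_mul_const' _ _ ENNReal.coe_ne_top, ← lintegral_indicator_one hm]
    congr 1
    refine lintegral_congr fun x => ?_
    by_cases h1 : x ∈ A <;> by_cases h2 : x - h ∈ A' <;> simp [h1, h2]
  simp only [hI3] at hI2
  rw [lintegral_eq_zero_iff'] at hI2
  · have hsupp : (volume.withDensity fun h => (ν h : ℝ≥0∞)).IsOpenPosMeasure := hsupp
    refine hU.measure_ne_zero (volume.withDensity fun h => (ν h : ℝ≥0∞)) hUne ?_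
    rw [withDensity_apply _ hU.measurableSet, lintegral_eq_zero_iff' hν.aemeasurable_coe.restrict]
    filter_upwards [ae_restrict_of_ae hI2, ae_restrict_mem hU.measurableSet] with h hh hhU
    exact (mul_eq_zero.1 hh).resolve_left (hUpos h hhU)
  · refine AEMeasurable.mul ?_ hν.aemeasurable_coe
    have hm : MeasurableSet {p : E d × E d | p.2 ∈ A ∧ p.2 - p.1 ∈ A'} :=
      (measurable_snd hA).inter ((measurable_snd.sub measurable_fst) hA')
    exact (measurable_measure_prodMk_left hm).aemeasurable

/-! ### Compactness in `L²(Ω)`. -/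

/-- Sequential Banach–Alaoglu in the dual, which Riesz identifies with `H`; separability is what
makes it sequential. -/
lemma exists_subseq_tendsto_inner {H : Type*} [NormedAddCommGroup H] [InnerProductSpace ℝ H]
    [CompleteSpace H] [TopologicalSpace.SeparableSpace H] {x : ℕ → H} {R : ℝ}
    (hx : ∀ n, ‖x n‖ ≤ R) : ∃ φ : ℕ → ℕ, StrictMono φ ∧ ∃ y : H, ∀ w,
      Tendsto (fun n => (inner ℝ (x (φ n)) w : ℝ)) atTop (𝓝 (inner ℝ y w)) := by
  have hc := WeakDual.isSeqCompact_closedBall ℝ H 0 R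
  obtain ⟨ℓ, -, φ, hφ, hlim⟩ := hc
    (x := fun n => StrongDual.toWeakDual (InnerProductSpace.toDual ℝ H (x n))) (by
      intro n
      simpa using hx n)
  refine ⟨φ, hφ, (InnerProductSpace.toDual ℝ H).symm (WeakDual.toStrongDual ℓ), fun w => ?_⟩
  rw [InnerProductSpace.toDual_symm_apply]
  exact ((WeakDual.eval_continuous w).tendsto ℓ).comp hlim

lemma energy_sub_le {ν : E d → ℝ≥0} (hν : IsSymmLevyDensity ν) {A B : Set (E d)} {u v : E d → ℝ}
    (huA : AEMeasurable u (volume.restrict A)) (huB : AEMeasurable u (volume.restrict B)) :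
    energy ν A B (fun x => u x - v x) ≤ 2 * energy ν A B u + 2 * energy ν A B v := by
  have hm := aemeasurable_energy hν huA huB
  rw [Measure.prod_restrict] at hm
  rw [energy, energy, energy, ← lintegral_const_mul'' _ hm, ← lintegral_const_mul' _ _ (by simp),
    ← lintegral_add_left' (hm.const_mul 2)]
  refine lintegral_mono fun p => ?_
  have := ofReal_add_sq_le (u p.1 - u p.2) (-(v p.1 - v p.2))
  rw [neg_sq] at this
  calc ENNReal.ofReal ((u p.1 - v p.1 - (u p.2 - v p.2)) ^ 2) * (ν (p.1 - p.2) : ℝ≥0∞)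
      = ENNReal.ofReal ((u p.1 - u p.2 + -(v p.1 - v p.2)) ^ 2) * (ν (p.1 - p.2) : ℝ≥0∞) := by
        congr 3; ring
    _ ≤ (2 * ENNReal.ofReal ((u p.1 - u p.2) ^ 2) + 2 * ENNReal.ofReal ((v p.1 - v p.2) ^ 2)) *
        (ν (p.1 - p.2) : ℝ≥0∞) := by gcongr
    _ = _ := by rw [add_mul, mul_assoc, mul_assoc]

/-- The truncation `min ν n`, as a real function. -/
def trunc (ν : E d → ℝ≥0) (n : ℕ) (h : E d) : ℝ := min (n : ℝ) (ν h)

lemma trunc_nonneg (ν : E d → ℝ≥0) (n : ℕ) (h : E d) : 0 ≤ trunc ν n h :=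
  le_min (Nat.cast_nonneg n) (ν h).2

lemma ofReal_trunc (ν : E d → ℝ≥0) (n : ℕ) (h : E d) :
    ENNReal.ofReal (trunc ν n h) = min (n : ℝ≥0∞) (ν h) := by
  rw [trunc, ENNReal.ofReal_min, ENNReal.ofReal_natCast, ENNReal.ofReal_coe_nnreal]

section trunc

variable {ν : E d → ℝ≥0} (hν : IsSymmLevyDensity ν) (n : ℕ)
include hν

lemma aemeasurable_trunc : AEMeasurable (trunc ν n) volume :=
  aemeasurable_const.min hν.aemeasurable.coe_nnreal_real

lemma memLp_trunc : MemLp (trunc ν n) 2 volume := by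
  rw [memLp_two_iff]
  refine ⟨(aemeasurable_trunc hν n).aestronglyMeasurable, ?_⟩
  have hle : ∀ h, ENNReal.ofReal (trunc ν n h ^ 2) ≤ n * min (n : ℝ≥0∞) (ν h) := by
    intro h
    rw [sq, ENNReal.ofReal_mul (trunc_nonneg _ _ _), ofReal_trunc]
    gcongr
    exact min_le_left _ _
  refine (lintegral_mono hle).trans_lt ?_
  rw [lintegral_const_mul' _ _ (ENNReal.natCast_ne_top n)]
  exact ENNReal.mul_lt_top (by simp) (hν.lintegral_min_lt_top n)

lemma memLp_trunc_sub (D : Set (E d)) (x : E d) :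
    MemLp (fun y => trunc ν n (x - y)) 2 (volume.restrict D) :=
  ((memLp_trunc hν n).comp_measurePreserving
    (Measure.measurePreserving_sub_left volume x)).restrict D

lemma eLpNorm_trunc_sub_le (D : Set (E d)) (x : E d) :
    eLpNorm (fun y => trunc ν n (x - y)) 2 (volume.restrict D) ≤ eLpNorm (trunc ν n) 2 volume := by
  refine (eLpNorm_mono_measure _ Measure.restrict_le_self).trans ?_
  exact (eLpNorm_comp_measurePreserving (aemeasurable_trunc hν n).aestronglyMeasurable
    (Measure.measurePreserving_sub_left volume x)).le

/-- A pointwise bound of `w` by its nonlocal energy density and a smoothing of `w`. -/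
lemma mul_ofReal_sq_le {D : Set (E d)} {w : E d → ℝ}
    (hw : MemLp w 2 (volume.restrict D)) {K : ℝ≥0} (hK : 1 ≤ K) {x : E d}
    (hx : (K : ℝ≥0∞) ≤ ∫⁻ y in D, min (n : ℝ≥0∞) (ν (x - y))) :
    K * ENNReal.ofReal (w x ^ 2) ≤
      2 * (∫⁻ y in D, ENNReal.ofReal ((w x - w y) ^ 2) * (ν (x - y) : ℝ≥0∞)) +
        4 * ENNReal.ofReal ((∫ y in D, w y * trunc ν n (x - y)) ^ 2) := by
  set J : E d → ℝ := fun y => trunc ν n (x - y) with hJ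
  have hJm : AEStronglyMeasurable J (volume.restrict D) := (memLp_trunc_sub hν n D x).1
  have hJ0 : ∀ y, 0 ≤ J y := fun y => trunc_nonneg _ _ _
  have hJi : Integrable J (volume.restrict D) := by
    refine ⟨hJm, ?_⟩
    rw [hasFiniteIntegral_iff_ofReal (Eventually.of_forall hJ0)]
    simp only [hJ, ofReal_trunc]
    refine (setLIntegral_le_lintegral _ _).trans_lt ?_
    rw [lintegral_sub_left_eq_self (fun h => min (n : ℝ≥0∞) (ν h)) x]
    exact hν.lintegral_min_lt_top n
  have hwJ : Integrable (fun y => w y * J y) (volume.restrict D) :=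
    hw.integrable_mul (memLp_trunc_sub hν n D x)
  have hw2J : Integrable (fun y => w y ^ 2 * J y) (volume.restrict D) := by
    refine hw.integrable_sq.mul_bdd (c := n) hJm (Eventually.of_forall fun y => ?_)
    rw [Real.norm_of_nonneg (hJ0 y)]
    exact min_le_left _ _
  set m := ∫ y in D, J y with hm
  set a := ∫ y in D, w y * J y with ha
  have hKm : (K : ℝ) ≤ m := by
    rw [hm, integral_eq_lintegral_of_nonneg_ae (Eventually.of_forall hJ0) hJm]
    simp only [hJ, ofReal_trunc]
    rw [← ENNReal.coe_toReal]
    refine ENNReal.toReal_mono ?_ hx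
    have := hJi.lintegral_lt_top
    simp only [hJ, ofReal_trunc] at this
    exact this.ne
  have hexp : ∀ y, (w x - w y) ^ 2 * J y =
      w x ^ 2 * J y - 2 * w x * (w y * J y) + w y ^ 2 * J y := fun y => by ring
  have hei : Integrable (fun y => (w x - w y) ^ 2 * J y) (volume.restrict D) := by
    simp only [hexp]
    exact ((hJi.const_mul _).sub (hwJ.const_mul _)).add hw2J
  have he : ∫ y in D, (w x - w y) ^ 2 * J y =
      w x ^ 2 * m - 2 * w x * a + ∫ y in D, w y ^ 2 * J y := by
    simp only [hexp]
    have h1 : Integrable (fun y => w x ^ 2 * J y) (volume.restrict D) := hJi.const_mul _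
    have h2 : Integrable (fun y => 2 * w x * (w y * J y)) (volume.restrict D) := hwJ.const_mul _
    have h12 : Integrable (fun y => w x ^ 2 * J y - 2 * w x * (w y * J y)) (volume.restrict D) :=
      h1.sub h2
    rw [integral_add h12 hw2J, integral_sub h1 h2, integral_const_mul, integral_const_mul]
  have hpos : 0 ≤ ∫ y in D, w y ^ 2 * J y :=
    integral_nonneg fun y => mul_nonneg (sq_nonneg _) (hJ0 y)
  have hepos : 0 ≤ ∫ y in D, (w x - w y) ^ 2 * J y :=
    integral_nonneg fun y => mul_nonneg (sq_nonneg _) (hJ0 y)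
  have hK1 : (1 : ℝ) ≤ K := by exact_mod_cast hK
  -- Expanding the square and dropping `∫ w²J ≥ 0` gives `m w² ≤ e + 2wa`, with `e` the truncated
  -- energy density at `x`. Then `2wa ≤ w²/2 + 2a²`, and `w² ≤ m w²`, from `K ≥ 1`, absorbs the
  -- first term.
  have hreal : K * w x ^ 2 ≤ 2 * (∫ y in D, (w x - w y) ^ 2 * J y) + 4 * a ^ 2 := by
    rw [he] at hepos ⊢
    have h1 : K * w x ^ 2 ≤ m * w x ^ 2 := by gcongr
    have h2 : 1 * w x ^ 2 ≤ m * w x ^ 2 := by gcongr; linarith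
    nlinarith [sq_nonneg (w x - 2 * a)]
  have hle : ENNReal.ofReal (∫ y in D, (w x - w y) ^ 2 * J y) ≤
      ∫⁻ y in D, ENNReal.ofReal ((w x - w y) ^ 2) * (ν (x - y) : ℝ≥0∞) := by
    rw [ofReal_integral_eq_lintegral_ofReal hei
      (Eventually.of_forall fun y => mul_nonneg (sq_nonneg _) (hJ0 y))]
    refine lintegral_mono fun y => ?_
    rw [ENNReal.ofReal_mul (sq_nonneg _), hJ, ofReal_trunc]
    gcongr
    exact min_le_right _ _
  calc K * ENNReal.ofReal (w x ^ 2) = ENNReal.ofReal (K * w x ^ 2) := by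
        rw [ENNReal.ofReal_mul K.coe_nonneg, ENNReal.ofReal_coe_nnreal]
    _ ≤ ENNReal.ofReal (2 * (∫ y in D, (w x - w y) ^ 2 * J y) + 4 * a ^ 2) :=
        ENNReal.ofReal_le_ofReal hreal
    _ = 2 * ENNReal.ofReal (∫ y in D, (w x - w y) ^ 2 * J y) + 4 * ENNReal.ofReal (a ^ 2) := by
        rw [ENNReal.ofReal_add (by positivity) (by positivity), ENNReal.ofReal_mul (by norm_num),
          ENNReal.ofReal_mul (by norm_num)]
        norm_num
    _ ≤ _ := by gcongr

end trunc

/-- Rellich-type compactness: if the truncations of `ν` have uniformly large mass in `D` seen from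
`Ω`, a bounded sequence of `H_ν(D)` has a subsequence which is Cauchy in `L²(Ω)`. -/
lemma exists_subseq_cauchy {ν : E d → ℝ≥0} (hν : IsSymmLevyDensity ν) {Ω D : Set (E d)}
    (hΩb : Bornology.IsBounded Ω) (hΩ : MeasurableSet Ω) (hD : IsOpen D) (hΩD : Ω ⊆ D)
    (htop : ∀ x ∈ closure Ω, ∫⁻ y in D, (ν (x - y) : ℝ≥0∞) = ∞) {v : ℕ → E d → ℝ} {M : ℝ≥0}
    (hv : ∀ n, MemLp (v n) 2 (volume.restrict D))
    (hM : ∀ n, eLpNorm (v n) 2 (volume.restrict D) ≤ M) (hE : ∀ n, energy ν D D (v n) ≤ M) :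
    ∃ φ : ℕ → ℕ, StrictMono φ ∧ ∀ ε : ℝ≥0, 0 < ε → ∃ N, ∀ i ≥ N, ∀ j ≥ N,
      ∫⁻ x in Ω, ENNReal.ofReal ((v (φ i) x - v (φ j) x) ^ 2) ≤ ε := by
  have hfact : Fact ((2 : ℝ≥0∞) ≠ ∞) := ⟨by norm_num⟩
  obtain ⟨φ, hφ, V, hV⟩ := exists_subseq_tendsto_inner
    (x := fun n => (hv n).toLp (v n)) (R := M) (by
      intro n
      rw [Lp.norm_toLp]
      exact ENNReal.toReal_le_coe_of_le_coe (hM n))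
  refine ⟨φ, hφ, fun ε hε => ?_⟩
  -- The final estimate is `K ∫ w² ≤ 8M + 16`: twice the energy `4M` of a difference, plus `8 + 8`
  -- from the smoothed terms.
  set K : ℝ≥0 := max 1 ((8 * M + 16) / ε) with hK
  obtain ⟨n, hn⟩ := exists_truncation_lintegral_ge hν hΩb hD htop K
  set j : E d → Lp ℝ 2 (volume.restrict D) := fun x => (memLp_trunc_sub hν n D x).toLp _ with hj
  have hinner : ∀ (w : E d → ℝ) (hw : MemLp w 2 (volume.restrict D)) (x : E d),
      (inner ℝ (hw.toLp w) (j x) : ℝ) = ∫ y in D, w y * trunc ν n (x - y) := by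
    intro w hw x
    rw [L2.inner_def]
    refine integral_congr_ae ?_
    filter_upwards [hw.coeFn_toLp, (memLp_trunc_sub hν n D x).coeFn_toLp] with y h1 h2
    rw [h1, h2]
    simp [mul_comm]
  -- The smoothing is a pairing with `j x`, so `b i` tends to zero pointwise by weak convergence. It
  -- is bounded uniformly in `x`, and `Ω` has finite measure, hence dominated convergence.
  set b : ℕ → E d → ℝ := fun i x =>
    inner ℝ ((hv (φ i)).toLp (v (φ i))) (j x) - inner ℝ V (j x) with hb
  have hmeas : ∀ w : Lp ℝ 2 (volume.restrict D),
      AEStronglyMeasurable (fun x => (inner ℝ w (j x) : ℝ)) (volume.restrict Ω) := by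
    intro w
    have h1 : (fun x => (inner ℝ w (j x) : ℝ)) = fun x => ∫ y in D, w y * trunc ν n (x - y) := by
      funext x
      rw [← hinner w (Lp.memLp w), Lp.toLp_coeFn]
    rw [h1]
    have h2 : AEStronglyMeasurable (fun p : E d × E d => w p.2 * trunc ν n (p.1 - p.2))
        ((volume.restrict Ω).prod (volume.restrict D)) := by
      refine (Lp.aestronglyMeasurable w).comp_snd.mul ?_
      rw [Measure.prod_restrict]
      exact ((aemeasurable_trunc hν n).comp_quasiMeasurePreserving
        (quasiMeasurePreserving_sub_of_right_invariant volume volume)).restrict.aestronglyMeasurable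
    exact h2.integral_prod_right'
  have hbm : ∀ i, AEMeasurable (fun x => ENNReal.ofReal (b i x ^ 2)) (volume.restrict Ω) :=
    fun i => (((hmeas _).sub (hmeas _)).aemeasurable.pow_const 2).ennreal_ofReal
  set R : ℝ := (M + ‖V‖) * (eLpNorm (trunc ν n) 2 volume).toReal with hR
  have hbR : ∀ i x, b i x ^ 2 ≤ R ^ 2 := by
    intro i x
    rw [← sq_abs]
    refine pow_le_pow_left₀ (abs_nonneg _) ?_ 2
    have hbi : b i x = inner ℝ ((hv (φ i)).toLp (v (φ i)) - V) (j x) := (inner_sub_left _ _ _).symm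
    rw [hbi]
    refine (abs_real_inner_le_norm _ _).trans (mul_le_mul ?_ ?_ (norm_nonneg _) (by positivity))
    · refine (norm_sub_le _ _).trans (add_le_add ?_ le_rfl)
      rw [Lp.norm_toLp]
      exact ENNReal.toReal_le_coe_of_le_coe (hM _)
    · rw [Lp.norm_toLp]
      exact ENNReal.toReal_mono (memLp_trunc hν n).2.ne (eLpNorm_trunc_sub_le hν n D x)
  have hlim : Tendsto (fun i => ∫⁻ x in Ω, ENNReal.ofReal (b i x ^ 2)) atTop (𝓝 0) := by
    have h := tendsto_lintegral_of_dominated_convergence' (μ := volume.restrict Ω)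
      (F := fun i x => ENNReal.ofReal (b i x ^ 2)) (f := fun _ => 0)
      (fun _ => ENNReal.ofReal (R ^ 2)) hbm
      (fun i => Eventually.of_forall fun x => ENNReal.ofReal_le_ofReal (hbR i x)) (by
        rw [lintegral_const, Measure.restrict_apply_univ]
        exact (ENNReal.mul_lt_top ENNReal.ofReal_lt_top hΩb.measure_lt_top).ne)
      (Eventually.of_forall fun x => by
        have h1 : Tendsto (fun i => b i x) atTop (𝓝 0) := by
          have := (hV (j x)).sub_const (inner ℝ V (j x))
          rwa [sub_self] at this
        have h2 := ENNReal.tendsto_ofReal (h1.pow 2)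
        simpa using h2)
    simpa using h
  -- The bound `1` is enough: smallness comes from dividing by `K`.
  obtain ⟨N, hN⟩ := eventually_atTop.1 (hlim.eventually_lt_const (u := 1) one_pos)
  refine ⟨N, fun i hi l hl => ?_⟩
  set w : E d → ℝ := fun x => v (φ i) x - v (φ l) x with hw
  have hwL : MemLp w 2 (volume.restrict D) := (hv (φ i)).sub (hv (φ l))
  have hK1 : 1 ≤ K := le_max_left _ _
  have hmD : ∀ k, AEMeasurable (v k) (volume.restrict D) := fun k => (hv k).1.aemeasurable
  have hmΩ : ∀ k, AEMeasurable (v k) (volume.restrict Ω) := fun k =>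
    (hmD k).mono_measure (Measure.restrict_mono_set _ hΩD)
  have hpt : ∀ x ∈ Ω, K * ENNReal.ofReal (w x ^ 2) ≤
      2 * (∫⁻ y in D, ENNReal.ofReal ((w x - w y) ^ 2) * (ν (x - y) : ℝ≥0∞)) +
        (8 * ENNReal.ofReal (b i x ^ 2) + 8 * ENNReal.ofReal (b l x ^ 2)) := by
    intro x hx
    refine (mul_ofReal_sq_le hν n hwL hK1 (hn x hx)).trans ?_
    gcongr
    have h1 : ∫ y in D, w y * trunc ν n (x - y) = b i x + -(b l x) := by
      rw [← hinner w hwL, hb]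
      have : hwL.toLp w = (hv (φ i)).toLp (v (φ i)) - (hv (φ l)).toLp (v (φ l)) := rfl
      rw [this, inner_sub_left]
      ring
    rw [h1]
    have h2 := ofReal_add_sq_le (b i x) (-(b l x))
    rw [neg_sq] at h2
    calc _ ≤ 4 * (2 * ENNReal.ofReal (b i x ^ 2) + 2 * ENNReal.ofReal (b l x ^ 2)) := by gcongr
      _ = _ := by ring
  have hint : K * ∫⁻ x in Ω, ENNReal.ofReal (w x ^ 2) ≤ 2 * energy ν Ω D w + (8 + 8) := by
    rw [← lintegral_const_mul' _ _ ENNReal.coe_ne_top]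
    refine (setLIntegral_mono' hΩ hpt).trans ?_
    have hbil : AEMeasurable (fun x => 8 * ENNReal.ofReal (b i x ^ 2) +
        8 * ENNReal.ofReal (b l x ^ 2)) (volume.restrict Ω) :=
      ((hbm i).const_mul 8).add ((hbm l).const_mul 8)
    rw [lintegral_add_right' _ hbil,
      lintegral_const_mul' _ _ (by simp), lintegral_add_left' ((hbm i).const_mul 8),
      lintegral_const_mul'' _ (hbm i), lintegral_const_mul'' _ (hbm l),
      ← energy_eq_lintegral (u := w) hν ((hmΩ _).sub (hmΩ _)) ((hmD _).sub (hmD _))]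
    gcongr
    · exact mul_le_of_le_one_right' (hN i hi).le
    · exact mul_le_of_le_one_right' (hN l hl).le
  have hEw : energy ν Ω D w ≤ 4 * M := by
    refine (energy_sub_le hν (hmΩ _) (hmD _)).trans ?_
    calc _ ≤ 2 * (M : ℝ≥0∞) + 2 * M := by
          gcongr <;> exact (energy_mono hΩD subset_rfl _).trans (hE _)
      _ = _ := by ring
  have hfin : K * ∫⁻ x in Ω, ENNReal.ofReal (w x ^ 2) ≤ ((8 * M + 16 : ℝ≥0) : ℝ≥0∞) := by
    refine hint.trans ?_
    push_cast
    calc _ ≤ 2 * (4 * (M : ℝ≥0∞)) + (8 + 8) := by gcongr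
      _ = _ := by ring
  have hKε : ((8 * M + 16 : ℝ≥0) : ℝ≥0∞) ≤ K * ε := by
    rw [← ENNReal.coe_mul, ENNReal.coe_le_coe]
    calc 8 * M + 16 = (8 * M + 16) / ε * ε := (div_mul_cancel₀ _ hε.ne').symm
      _ ≤ K * ε := by gcongr; exact le_max_right _ _
  have hK0 : (K : ℝ≥0∞) ≠ 0 := by
    rw [ENNReal.coe_ne_zero]; exact (one_pos.trans_le hK1).ne'
  exact (ENNReal.mul_le_mul_iff_right hK0 ENNReal.coe_ne_top).1 (hfin.trans hKε)

/-- Completeness of `L²` for honest functions; the subsequence converging a.e. is what Fatou's lemma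
needs later. -/
lemma exists_limit_of_cauchy {α : Type*} [MeasurableSpace α] {μ : Measure α} {f : ℕ → α → ℝ}
    (hf : ∀ n, MemLp (f n) 2 μ)
    (hC : ∀ ε : ℝ≥0, 0 < ε → ∃ N, ∀ i ≥ N, ∀ j ≥ N,
      ∫⁻ x, ENNReal.ofReal ((f i x - f j x) ^ 2) ∂μ ≤ ε) :
    ∃ g : α → ℝ, MemLp g 2 μ ∧
      Tendsto (fun n => ∫⁻ x, ENNReal.ofReal ((f n x - g x) ^ 2) ∂μ) atTop (𝓝 0) ∧
      ∃ ψ : ℕ → ℕ, StrictMono ψ ∧ ∀ᵐ x ∂μ, Tendsto (fun n => f (ψ n) x) atTop (𝓝 (g x)) := by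
  set F : ℕ → Lp ℝ 2 μ := fun n => (hf n).toLp (f n) with hF
  have hcau : CauchySeq F := by
    rw [EMetric.cauchySeq_iff]
    intro ε hε
    obtain ⟨δ, hδ0, hδ⟩ := ENNReal.lt_iff_exists_nnreal_btwn.1 hε
    have hδ0 : 0 < δ := by exact_mod_cast hδ0
    obtain ⟨N, hN⟩ := hC (δ ^ 2) (by positivity)
    refine ⟨N, fun i hi j hj => lt_of_le_of_lt ?_ hδ⟩
    rw [Lp.edist_toLp_toLp]
    have := hN i hi j hj
    have h2 := sq_eLpNorm_two μ (f i - f j)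
    simp only [Pi.sub_apply] at h2
    rw [← h2, ENNReal.coe_pow] at this
    exact (ENNReal.pow_le_pow_left_iff two_ne_zero).1 this
  obtain ⟨G, hG⟩ := cauchySeq_tendsto_of_complete hcau
  have hG2 := (Lp.tendsto_Lp_iff_tendsto_eLpNorm'' f hf G (Lp.memLp G)).1
    (by rwa [Lp.toLp_coeFn])
  refine ⟨G, Lp.memLp G, ?_, ?_⟩
  · have := (((ENNReal.continuous_pow 2).tendsto 0).comp hG2).congr fun n => sq_eLpNorm_two μ _
    simpa using this
  · exact (tendstoInMeasure_of_tendsto_eLpNorm two_ne_zero (fun n => (hf n).1)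
      (Lp.aestronglyMeasurable G) hG2).exists_seq_tendsto_ae

lemma MemV.energy_self_lt_top {ν : E d → ℝ≥0} {Ω : Set (E d)} {u : E d → ℝ} (hu : MemV ν Ω u) :
    energy ν Ω Ω u < ∞ :=
  (energy_mono subset_rfl (Set.subset_univ _) u).trans_lt hu.energy_lt_top

/-- Bounded sequences of `V_ν(Ω|ℝ^d)` are relatively compact in `L²(Ω)`. -/
lemma exists_subseq_cauchy_of_class {ν : E d → ℝ≥0} (hν : IsSymmLevyDensity ν) {Ω : Set (E d)}
    (hd : 1 ≤ d) (hΩo : IsOpen Ω) (hΩb : Bornology.IsBounded Ω)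
    (hint : ∫⁻ h, (ν h : ℝ≥0∞) = ∞) (hclass : ClassA1 ν Ω ∨ ClassA2 ν Ω ∨ ClassA3 ν Ω)
    {v : ℕ → E d → ℝ} (hv : ∀ n, MemV ν Ω (v n)) {M : ℝ≥0}
    (hM : ∀ n, eLpNorm (v n) 2 (volume.restrict Ω) ≤ M)
    (hE : ∀ n, energy ν Ω Set.univ (v n) ≤ M) :
    ∃ φ : ℕ → ℕ, StrictMono φ ∧ ∀ ε : ℝ≥0, 0 < ε → ∃ N, ∀ i ≥ N, ∀ j ≥ N,
      ∫⁻ x in Ω, ENNReal.ofReal ((v (φ i) x - v (φ j) x) ^ 2) ≤ ε := by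
  have hE' : ∀ n, energy ν Ω Ω (v n) ≤ M := fun n =>
    (energy_mono subset_rfl (Set.subset_univ _) _).trans (hE n)
  rcases hclass with ⟨Ext, C, hC, hExt⟩ | hclass
  · have hExt' := fun n => hExt (v n) ⟨(hv n).memLp, (hv n).energy_self_lt_top⟩
    set S : ℝ := C * Real.sqrt ((M : ℝ) ^ 2 + M) with hS
    have hbound : ∀ n, (eLpNorm (Ext (v n)) 2 volume).toReal ^ 2 +
        (energy ν Set.univ Set.univ (Ext (v n))).toReal ≤ S ^ 2 := by
      intro n
      have h1 := (hExt' n).2.2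
      have h2 : normH ν Ω (v n) ≤ Real.sqrt ((M : ℝ) ^ 2 + M) := by
        refine Real.sqrt_le_sqrt ?_
        have a1 := ENNReal.toReal_le_coe_of_le_coe (hM n)
        have a2 := ENNReal.toReal_le_coe_of_le_coe (hE' n)
        gcongr
      have h3 : normH ν Set.univ (Ext (v n)) ≤ S := h1.trans (by rw [hS]; gcongr)
      rw [normH, Measure.restrict_univ] at h3
      exact (Real.sqrt_le_left (by positivity)).1 h3
    -- One constant bounding both the norm (by `S`) and the energy (by `S²`) of the extensions.
    -- Differences are taken after extending, so linearity of `Ext` plays no role.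
    set M' : ℝ≥0 := Real.toNNReal (S + S ^ 2) with hM'
    have hS0 : 0 ≤ S := by positivity
    have hM'c : (M' : ℝ) = S + S ^ 2 := Real.coe_toNNReal _ (by positivity)
    obtain ⟨φ, hφ, hcau⟩ := exists_subseq_cauchy hν (v := fun n => Ext (v n)) (M := M') hΩb
      hΩo.measurableSet isOpen_univ (Set.subset_univ _)
      (fun x _ => by
        rw [Measure.restrict_univ, lintegral_sub_left_eq_self (fun h => (ν h : ℝ≥0∞)) x, hint])
      (fun n => (hExt' n).1.1)
      (fun n => by
        have hfin := (hExt' n).1.1.2.ne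
        rw [Measure.restrict_univ] at hfin ⊢
        rw [← ENNReal.coe_toNNReal hfin, ENNReal.coe_le_coe, ← NNReal.coe_le_coe, hM'c]
        have h1 : (eLpNorm (Ext (v n)) 2 volume).toReal ^ 2 ≤ S ^ 2 :=
          (le_add_of_nonneg_right ENNReal.toReal_nonneg).trans (hbound n)
        have h2 := (pow_le_pow_iff_left₀ ENNReal.toReal_nonneg hS0 two_ne_zero).1 h1
        exact h2.trans (le_add_of_nonneg_right (sq_nonneg _)))
      (fun n => by
        have hfin := (hExt' n).1.2.ne
        rw [← ENNReal.coe_toNNReal hfin, ENNReal.coe_le_coe, ← NNReal.coe_le_coe, hM'c]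
        exact ((le_add_of_nonneg_left (sq_nonneg _)).trans (hbound n)).trans
          (le_add_of_nonneg_left hS0))
    refine ⟨φ, hφ, fun ε hε => ?_⟩
    obtain ⟨N, hN⟩ := hcau ε hε
    refine ⟨N, fun i hi j hj => le_trans (le_of_eq ?_) (hN i hi j hj)⟩
    refine lintegral_congr_ae ?_
    filter_upwards [(hExt' (φ i)).2.1, (hExt' (φ j)).2.1] with x h1 h2
    rw [h1, h2]
  · refine exists_subseq_cauchy hν hΩb hΩo.measurableSet hΩo subset_rfl ?_
      (fun n => (hv n).memLp) hM hE'
    intro x hx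
    rw [closure_eq_self_union_frontier] at hx
    rcases hx with hx | hx
    · obtain ⟨r, hr, hball⟩ := Metric.isOpen_iff.1 hΩo x hx
      exact hν.setLIntegral_sub_eq_top_of_ball hint hr hΩo.measurableSet hball
    · rcases hclass with h | h
      · exact h.lintegral_eq_top hd hΩo hν hint hx
      · exact h.lintegral_eq_top hν hx

/-! ### The Poincaré inequality. -/

lemma energy_const_mul {ν : E d → ℝ≥0} {A B : Set (E d)} (c : ℝ) (u : E d → ℝ) :
    energy ν A B (fun x => c * u x) = ENNReal.ofReal (c ^ 2) * energy ν A B u := by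
  rw [energy, energy, ← lintegral_const_mul' _ _ ENNReal.ofReal_ne_top]
  refine lintegral_congr fun p => ?_
  rw [← mul_sub, mul_pow, ENNReal.ofReal_mul (sq_nonneg c), mul_assoc]

lemma lintegral_ofReal_sq_const_mul {α : Type*} [MeasurableSpace α] (μ : Measure α) (c : ℝ)
    (u : α → ℝ) (β : α → ℝ≥0∞) : ∫⁻ x, ENNReal.ofReal ((c * u x) ^ 2) * β x ∂μ =
      ENNReal.ofReal (c ^ 2) * ∫⁻ x, ENNReal.ofReal (u x ^ 2) * β x ∂μ := by
  rw [← lintegral_const_mul' _ _ ENNReal.ofReal_ne_top]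
  refine lintegral_congr fun p => ?_
  rw [mul_pow, ENNReal.ofReal_mul (sq_nonneg c), mul_assoc]

lemma MemV.const_mul {ν : E d → ℝ≥0} {Ω : Set (E d)} {u : E d → ℝ} (hu : MemV ν Ω u) (c : ℝ) :
    MemV ν Ω (fun x => c * u x) where
  aemeasurable := hu.aemeasurable.const_mul c
  memLp := hu.memLp.const_mul c
  energy_lt_top := by
    rw [energy_const_mul]
    exact ENNReal.mul_lt_top ENNReal.ofReal_lt_top hu.energy_lt_top

/-- Fatou's lemma on the product; convergence is required only on `A` and on `B`, so a limit known
only on `Ω` is admissible. -/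
lemma energy_le_liminf {ν : E d → ℝ≥0} (hν : IsSymmLevyDensity ν) {A B : Set (E d)}
    {u : ℕ → E d → ℝ} {w : E d → ℝ} (hA : ∀ n, AEMeasurable (u n) (volume.restrict A))
    (hB : ∀ n, AEMeasurable (u n) (volume.restrict B))
    (hlimA : ∀ᵐ x ∂(volume.restrict A), Tendsto (fun n => u n x) atTop (𝓝 (w x)))
    (hlimB : ∀ᵐ x ∂(volume.restrict B), Tendsto (fun n => u n x) atTop (𝓝 (w x))) :
    energy ν A B w ≤ liminf (fun n => energy ν A B (u n)) atTop := by
  simp only [energy, ← Measure.prod_restrict]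
  refine le_trans (le_of_eq ?_) (lintegral_liminf_le' fun n => aemeasurable_energy hν (hA n) (hB n))
  refine lintegral_congr_ae ?_
  filter_upwards [Measure.quasiMeasurePreserving_fst.ae hlimA,
    Measure.quasiMeasurePreserving_snd.ae hlimB] with p h1 h2
  refine (Tendsto.liminf_eq ?_).symm
  exact ENNReal.Tendsto.mul_const (ENNReal.tendsto_ofReal ((h1.sub h2).pow 2))
    (Or.inr ENNReal.coe_ne_top)

lemma lintegral_sq_mul_le {ν : E d → ℝ≥0} {Ω B : Set (E d)} {β : E d → ℝ} {M : ℝ≥0}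
    (hν : IsSymmLevyDensity ν)
    (hM : ∀ᵐ y ∂(volume.restrict Ωᶜ), ENNReal.ofReal (β y) * (nuTilde ν B y)⁻¹ ≤ (M : ℝ≥0∞))
    (hpos : ∀ y, 0 < nuTilde ν B y) (w : E d → ℝ) :
    ∫⁻ y in Ωᶜ, ENNReal.ofReal (w y ^ 2) * ENNReal.ofReal (β y) ≤
      M * ∫⁻ y, ENNReal.ofReal (w y ^ 2) * nuTilde ν B y := by
  rw [← lintegral_const_mul' _ _ ENNReal.coe_ne_top]
  refine le_trans (lintegral_mono_ae ?_) (setLIntegral_le_lintegral Ωᶜ _)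
  filter_upwards [hM] with y hy
  rw [← div_eq_mul_inv, ENNReal.div_le_iff (hpos y).ne' (nuTilde_lt_top hν y).ne] at hy
  calc _ ≤ ENNReal.ofReal (w y ^ 2) * (M * nuTilde ν B y) := by gcongr
    _ = _ := by ring

/-- The Poincaré inequality for the Robin problem. -/
lemma exists_poincare_robin {ν : E d → ℝ≥0} (hν : IsSymmLevyDensity ν) (hsupp : HasFullSupport ν)
    {Ω B : Set (E d)} (hd : 1 ≤ d) (hΩo : IsOpen Ω) (hΩb : Bornology.IsBounded Ω)
    (hint : ∫⁻ h, (ν h : ℝ≥0∞) = ∞) (hclass : ClassA1 ν Ω ∨ ClassA2 ν Ω ∨ ClassA3 ν Ω)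
    (hB : IsOpen B) (hBne : B.Nonempty) (hBΩ : B ⊆ Ω) {β : E d → ℝ}
    (hβm : AEMeasurable β (volume.restrict Ωᶜ))
    {M : ℝ≥0} (hM : ∀ᵐ y ∂(volume.restrict Ωᶜ),
      ENNReal.ofReal (β y) * (nuTilde ν B y)⁻¹ ≤ (M : ℝ≥0∞))
    (hβpos : 0 < volume (Ωᶜ ∩ {y | 0 < β y})) :
    ∃ c : ℝ≥0, ∀ u, MemV ν Ω u → ∫⁻ x in Ω, ENNReal.ofReal (u x ^ 2) ≤
      c * (energy ν Ω Set.univ u +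
        ∫⁻ y in Ωᶜ, ENNReal.ofReal (u y ^ 2) * ENNReal.ofReal (β y)) := by
  set P : (E d → ℝ) → ℝ≥0∞ := fun u => energy ν Ω Set.univ u +
        ∫⁻ y in Ωᶜ, ENNReal.ofReal (u y ^ 2) * ENNReal.ofReal (β y) with hP
  have hpos := nuTilde_pos hν hsupp hB hBne
  by_contra! hcon
  have hnorm : ∀ n : ℕ, ∃ w, MemV ν Ω w ∧ ∫⁻ x in Ω, ENNReal.ofReal (w x ^ 2) = 1 ∧
      P w ≤ ((n : ℝ≥0∞) + 1)⁻¹ := by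
    intro n
    obtain ⟨u, hu, hlt⟩ := hcon (n + 1)
    change _ * P u < _ at hlt
    set N := ∫⁻ x in Ω, ENNReal.ofReal (u x ^ 2) with hN
    have hN0 : N ≠ 0 := (bot_le.trans_lt hlt).ne'
    have hNt : N ≠ ∞ := (memLp_two_iff.1 hu.memLp).2.ne
    have hNr : 0 < N.toReal := ENNReal.toReal_pos hN0 hNt
    -- Normalises `u` in `L²(Ω)`; both terms of `P` scale by `c² = N⁻¹`.
    set c : ℝ := (Real.sqrt N.toReal)⁻¹ with hc
    have hc2 : ENNReal.ofReal (c ^ 2) = N⁻¹ := by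
      rw [hc, inv_pow, Real.sq_sqrt hNr.le, ENNReal.ofReal_inv_of_pos hNr, ENNReal.ofReal_toReal hNt]
    refine ⟨fun x => c * u x, hu.const_mul c, ?_, ?_⟩
    · have := lintegral_ofReal_sq_const_mul (volume.restrict Ω) c u 1
      simp only [Pi.one_apply, mul_one] at this
      rw [this, hc2, ENNReal.inv_mul_cancel hN0 hNt]
    · have h1 : P (fun x => c * u x) = N⁻¹ * P u := by
        simp only [hP]
        rw [energy_const_mul, lintegral_ofReal_sq_const_mul, hc2, mul_add]
      rw [h1, ENNReal.le_inv_iff_mul_le]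
      push_cast at hlt
      calc N⁻¹ * P u * (n + 1) = N⁻¹ * ((n + 1) * P u) := by ring
        _ ≤ N⁻¹ * N := by gcongr
        _ = 1 := ENNReal.inv_mul_cancel hN0 hNt
  choose w hw hw1 hwP using hnorm
  have hPw : Tendsto (fun n => P (w n)) atTop (𝓝 0) := by
    have h1 : Tendsto (fun n : ℕ => ((n : ℝ≥0∞) + 1)⁻¹) atTop (𝓝 0) := by
      have := (tendsto_add_atTop_iff_nat 1).2 ENNReal.tendsto_inv_nat_nhds_zero
      simpa using this
    exact tendsto_of_tendsto_of_tendsto_of_le_of_le tendsto_const_nhds h1 (fun _ => bot_le) hwP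
  have hEP : ∀ u, energy ν Ω Set.univ u ≤ P u := fun u => le_self_add
  obtain ⟨φ, hφ, hcau⟩ := exists_subseq_cauchy_of_class hν hd hΩo hΩb hint hclass hw (M := 1)
    (fun n => by
      have := sq_eLpNorm_two (volume.restrict Ω) (w n)
      rw [hw1] at this
      exact (pow_le_one_iff two_ne_zero).1 this.le)
    (fun n => (hEP _).trans ((hwP n).trans (by simp)))
  obtain ⟨g, hgL, hglim, ψ, hψ, hgae⟩ := exists_limit_of_cauchy (fun n => (hw (φ n)).memLp) hcau
  have hPφ := hPw.comp hφ.tendsto_atTop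
  have hEφ : Tendsto (fun n => energy ν Ω Set.univ (w (φ n))) atTop (𝓝 0) :=
    tendsto_of_tendsto_of_tendsto_of_le_of_le tendsto_const_nhds hPφ (fun _ => bot_le)
      (fun n => hEP _)
  have hmΩ : ∀ n, AEMeasurable (w n) (volume.restrict Ω) := fun n => (hw n).aemeasurable.restrict
  have hg0 : energy ν Ω Ω g = 0 := by
    refine le_antisymm ?_ bot_le
    refine (energy_le_liminf hν (fun n => hmΩ (φ (ψ n))) (fun n => hmΩ (φ (ψ n))) hgae hgae).trans ?_
    rw [Tendsto.liminf_eq]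
    exact tendsto_of_tendsto_of_tendsto_of_le_of_le tendsto_const_nhds (hEφ.comp hψ.tendsto_atTop)
      (fun _ => bot_le) (fun n => energy_mono subset_rfl (Set.subset_univ _) _)
  obtain ⟨c, hc⟩ := ae_eq_const_of_energy_eq_zero hν hsupp hΩo.measurableSet hgL.1.aemeasurable hg0
  have hclim : Tendsto (fun n => ∫⁻ x in Ω, ENNReal.ofReal ((w (φ n) x - c) ^ 2)) atTop (𝓝 0) := by
    refine hglim.congr fun n => lintegral_congr_ae ?_
    filter_upwards [hc] with x hx
    rw [hx]
  set κ := ∫⁻ h, min 1 (ν h : ℝ≥0∞) with hκ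
  have hκt : κ ≠ ∞ := by simpa using (hν.lintegral_min_lt_top 1).ne
  -- Write `c = v - (v - c)` against `β`. The first part is in `P v`; the second is a trace term,
  -- and subtracting `c` leaves the energy unchanged.
  have hle : ∀ n, ENNReal.ofReal (c ^ 2) * ∫⁻ y in Ωᶜ, ENNReal.ofReal (β y) ≤
      2 * P (w (φ n)) + 2 * (M * (2 * P (w (φ n)) +
        2 * κ * ∫⁻ x in Ω, ENNReal.ofReal ((w (φ n) x - c) ^ 2))) := by
    intro n
    set v := w (φ n) with hv
    have hvm : AEMeasurable v volume := (hw (φ n)).aemeasurable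
    have htr := lintegral_sq_mul_nuTilde_le hν (B := B) (w := fun x => v x - c)
      (hvm.sub_const c)
    have hEc : energy ν B Set.univ (fun x => v x - c) = energy ν B Set.univ v := by
      simp only [energy, sub_sub_sub_cancel_right]
    have h1 : ∫⁻ y, ENNReal.ofReal ((v y - c) ^ 2) * nuTilde ν B y ≤ 2 * P v +
        2 * κ * ∫⁻ x in Ω, ENNReal.ofReal ((v x - c) ^ 2) := by
      refine htr.trans ?_
      rw [hEc]
      gcongr
      exact (energy_mono hBΩ subset_rfl _).trans (hEP _)
    have hβo : AEMeasurable (fun y => ENNReal.ofReal (v y ^ 2) * ENNReal.ofReal (β y))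
        (volume.restrict Ωᶜ) := (hvm.restrict.pow_const 2).ennreal_ofReal.mul hβm.ennreal_ofReal
    calc ENNReal.ofReal (c ^ 2) * ∫⁻ y in Ωᶜ, ENNReal.ofReal (β y)
        = ∫⁻ y in Ωᶜ, ENNReal.ofReal (c ^ 2) * ENNReal.ofReal (β y) :=
          (lintegral_const_mul' _ _ ENNReal.ofReal_ne_top).symm
      _ ≤ ∫⁻ y in Ωᶜ, (2 * (ENNReal.ofReal (v y ^ 2) * ENNReal.ofReal (β y)) +
          2 * (ENNReal.ofReal ((v y - c) ^ 2) * ENNReal.ofReal (β y))) := by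
          refine lintegral_mono fun y => ?_
          have h2 := ofReal_add_sq_le (v y) (-(v y - c))
          rw [neg_sq, show v y + -(v y - c) = c by ring] at h2
          simp only [← mul_assoc, ← add_mul]
          gcongr
      _ = 2 * (∫⁻ y in Ωᶜ, ENNReal.ofReal (v y ^ 2) * ENNReal.ofReal (β y)) +
          2 * ∫⁻ y in Ωᶜ, ENNReal.ofReal ((v y - c) ^ 2) * ENNReal.ofReal (β y) := by
          rw [lintegral_add_left' (hβo.const_mul 2), lintegral_const_mul' _ _ (by simp),
            lintegral_const_mul' _ _ (by simp)]
      _ ≤ _ := by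
          gcongr
          · exact le_add_self
          · exact (lintegral_sq_mul_le hν hM hpos (fun y => v y - c)).trans (by gcongr)
  have hlim0 : Tendsto (fun n => 2 * P (w (φ n)) + 2 * (M * (2 * P (w (φ n)) +
        2 * κ * ∫⁻ x in Ω, ENNReal.ofReal ((w (φ n) x - c) ^ 2)))) atTop (𝓝 0) := by
    have h2 : (2 : ℝ≥0∞) ≠ ∞ := by simp
    have a1 : Tendsto (fun n => 2 * P (w (φ n))) atTop (𝓝 (2 * 0)) :=
      ENNReal.Tendsto.const_mul hPφ (Or.inr h2)
    have a2 := ENNReal.Tendsto.const_mul hclim (a := 2 * κ) (Or.inr (ENNReal.mul_ne_top h2 hκt))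
    have a3 := a1.add (ENNReal.Tendsto.const_mul (ENNReal.Tendsto.const_mul (a1.add a2)
      (a := (M : ℝ≥0∞)) (Or.inr ENNReal.coe_ne_top)) (Or.inr h2))
    simpa using a3
  have hz : ENNReal.ofReal (c ^ 2) * ∫⁻ y in Ωᶜ, ENNReal.ofReal (β y) = 0 :=
    le_antisymm (ge_of_tendsto' hlim0 hle) bot_le
  have hβ0 : ∫⁻ y in Ωᶜ, ENNReal.ofReal (β y) ≠ 0 := by
    intro h0
    rw [lintegral_eq_zero_iff' hβm.ennreal_ofReal, EventuallyEq,
      ae_restrict_iff' hΩo.measurableSet.compl] at h0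
    refine hβpos.ne' (measure_mono_null ?_ (ae_iff.1 h0))
    rintro y ⟨hy1, hy2⟩ hy3
    have hy2 : 0 < β y := hy2
    have := hy3 hy1
    rw [Pi.zero_apply, ENNReal.ofReal_eq_zero] at this
    exact this.not_gt hy2
  have hc0 : c = 0 := by
    have := (mul_eq_zero.1 hz).resolve_right hβ0
    rw [ENNReal.ofReal_eq_zero] at this
    exact pow_eq_zero_iff two_ne_zero |>.1 (le_antisymm this (sq_nonneg c))
  simp only [hc0, sub_zero, hw1] at hclim
  exact one_ne_zero (tendsto_nhds_unique tendsto_const_nhds hclim)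

/-! ### Hilbert space and `L²` tools. -/

/-- The Riesz representation theorem for a semi-inner product induced by a linear map with closed
range. -/
lemma exists_inner_eq_of_isClosed_range {V H : Type*} [AddCommGroup V] [Module ℝ V]
    [NormedAddCommGroup H] [InnerProductSpace ℝ H] [CompleteSpace H] (ι : V →ₗ[ℝ] H)
    (hι : IsClosed (LinearMap.range ι : Set H)) (ℓ : V →ₗ[ℝ] ℝ) {C : ℝ} (hC : 0 ≤ C)
    (hℓ : ∀ v, |ℓ v| ≤ C * ‖ι v‖) :
    ∃ u, ‖ι u‖ ≤ C ∧ ∀ v, (inner ℝ (ι u) (ι v) : ℝ) = ℓ v := by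
  have hcomp : CompleteSpace (LinearMap.range ι) := hι.completeSpace_coe
  -- A linear section of `ι` transports `ℓ` to the range. The choice is immaterial, since the bound
  -- `hℓ` makes `ℓ` vanish on the kernel of `ι`.
  obtain ⟨s, hs⟩ := ι.rangeRestrict.exists_rightInverse_of_surjective ι.range_rangeRestrict
  have hs' : ∀ w, ι (s w) = w := fun w => by
    have := congrArg Subtype.val (LinearMap.congr_fun hs w)
    simpa using this
  set L : StrongDual ℝ (LinearMap.range ι) := (ℓ.comp s).mkContinuous C (fun w => by
    have := hℓ (s w)
    rw [hs'] at this
    simpa using this) with hL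
  set z := (InnerProductSpace.toDual ℝ (LinearMap.range ι)).symm L with hz
  obtain ⟨u, hu⟩ := z.2
  have hr : ∀ v, ((ι.rangeRestrict v : LinearMap.range ι) : H) = ι v := fun _ => rfl
  have hin : ∀ v, (inner ℝ (ι u) (ι v) : ℝ) = ℓ v := by
    intro v
    have h1 : (inner ℝ z (ι.rangeRestrict v) : ℝ) = ℓ (s (ι.rangeRestrict v)) := by
      rw [hz, InnerProductSpace.toDual_symm_apply]
      rfl
    have h2 : ℓ (s (ι.rangeRestrict v)) = ℓ v := by
      have h3 := hℓ (s (ι.rangeRestrict v) - v)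
      rw [ι.map_sub, hs', hr, sub_self, norm_zero, mul_zero, ℓ.map_sub] at h3
      exact sub_eq_zero.1 (abs_nonpos_iff.1 h3)
    rw [← h2, ← h1, Submodule.coe_inner, hu, hr]
  refine ⟨u, ?_, hin⟩
  have h4 := (le_abs_self _).trans (hℓ u)
  rw [← hin u, real_inner_self_eq_norm_sq] at h4
  by_contra! hlt
  nlinarith [norm_nonneg (ι u)]

/-- An `L²` limit is also an a.e. limit along a subsequence, so the two limits coincide. -/
lemma toLp_eq_of_tendsto {α : Type*} [MeasurableSpace α] {μ : Measure α} {f : ℕ → α → ℝ}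
    {g : α → ℝ} (hf : ∀ n, MemLp (f n) 2 μ) (hg : MemLp g 2 μ) {G : Lp ℝ 2 μ}
    (hG : Tendsto (fun n => (hf n).toLp (f n)) atTop (𝓝 G))
    (hae : ∀ᵐ x ∂μ, Tendsto (fun n => f n x) atTop (𝓝 (g x))) : hg.toLp g = G := by
  have hG2 := (Lp.tendsto_Lp_iff_tendsto_eLpNorm'' f hf G (Lp.memLp G)).1
    (by rwa [Lp.toLp_coeFn])
  obtain ⟨ψ, hψ, hψae⟩ := (tendstoInMeasure_of_tendsto_eLpNorm two_ne_zero (fun n => (hf n).1)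
    (Lp.aestronglyMeasurable G) hG2).exists_seq_tendsto_ae
  refine Lp.ext ?_
  filter_upwards [hg.coeFn_toLp, hae, hψae] with x h1 h2 h3
  rw [h1]
  exact tendsto_nhds_unique (h2.comp hψ.tendsto_atTop) h3

/-- Weighted Cauchy–Schwarz inequality. -/
lemma lintegral_enorm_mul_le {α : Type*} [MeasurableSpace α] {μ : Measure α} {θ : α → ℝ≥0∞}
    (hθ : AEMeasurable θ μ) (hθ0 : ∀ x, θ x ≠ 0) (hθt : ∀ x, θ x ≠ ∞) {g u : α → ℝ}
    (hg : AEMeasurable g μ) (hu : AEMeasurable u μ) :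
    ∫⁻ x, ‖g x * u x‖ₑ ∂μ ≤
      eLpNorm g 2 (μ.withDensity fun x => (θ x)⁻¹) * eLpNorm u 2 (μ.withDensity θ) := by
  have key : ∀ (ρ : α → ℝ≥0∞) (w : α → ℝ), AEMeasurable ρ μ → AEMeasurable w μ →
      (∫⁻ x, (‖w x‖ₑ * ρ x ^ (1 / 2 : ℝ)) ^ (2 : ℝ) ∂μ) ^ (1 / 2 : ℝ) =
        eLpNorm w 2 (μ.withDensity ρ) := by
    intro ρ w hρ hw
    have h1 : ∫⁻ x, (‖w x‖ₑ * ρ x ^ (1 / 2 : ℝ)) ^ (2 : ℝ) ∂μ =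
        eLpNorm w 2 (μ.withDensity ρ) ^ (2 : ℝ) := by
      rw [ENNReal.rpow_two, sq_eLpNorm_two,
        lintegral_withDensity_eq_lintegral_mul₀ hρ (hw.pow_const 2).ennreal_ofReal]
      refine lintegral_congr fun x => ?_
      rw [ENNReal.mul_rpow_of_nonneg _ _ (by norm_num), ← ENNReal.rpow_mul, Pi.mul_apply, mul_comm]
      norm_num
      rw [Real.enorm_eq_ofReal_abs, ← ENNReal.ofReal_pow (abs_nonneg _), sq_abs]
    rw [h1, ← ENNReal.rpow_mul]
    norm_num
  rw [← key (fun x => (θ x)⁻¹) g hθ.inv hg, ← key _ u hθ hu]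
  refine le_trans (le_of_eq ?_) (ENNReal.lintegral_mul_le_Lp_mul_Lq μ Real.HolderConjugate.two_two
    (hg.enorm.mul (hθ.inv.pow_const _)) (hu.enorm.mul (hθ.pow_const _)))
  refine lintegral_congr fun x => ?_
  simp only [Pi.mul_apply]
  rw [enorm_mul, mul_mul_mul_comm, ENNReal.inv_rpow, ENNReal.inv_mul_cancel, mul_one]
  · simp [hθ0 x, hθt x]
  · exact ENNReal.rpow_ne_top_of_nonneg (by norm_num) (hθt x)

/-! ### The space `V_ν(Ω|ℝ^d)` and coercivity of the form. -/

lemma MemV.add {ν : E d → ℝ≥0} (hν : IsSymmLevyDensity ν) {Ω : Set (E d)} {u v : E d → ℝ}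
    (hu : MemV ν Ω u) (hv : MemV ν Ω v) : MemV ν Ω (u + v) where
  aemeasurable := hu.aemeasurable.add hv.aemeasurable
  memLp := hu.memLp.add hv.memLp
  energy_lt_top := by
    have h := energy_sub_le hν (A := Ω) (B := Set.univ) (v := fun x => (-1) * v x)
      hu.aemeasurable.restrict hu.aemeasurable.restrict
    have he : (fun x => u x - (-1) * v x) = u + v := by
      funext x
      simp
    rw [he] at h
    refine h.trans_lt (ENNReal.add_lt_top.2 ⟨ENNReal.mul_lt_top (by simp) hu.energy_lt_top,
      ENNReal.mul_lt_top (by simp) (hv.const_mul (-1)).energy_lt_top⟩)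

/-- The space `V_ν(Ω|ℝ^d)`, as a space of functions. -/
def spaceV {ν : E d → ℝ≥0} (hν : IsSymmLevyDensity ν) (Ω : Set (E d)) :
    Submodule ℝ (E d → ℝ) where
  carrier := {u | MemV ν Ω u}
  add_mem' := fun hu hv => MemV.add hν hu hv
  zero_mem' := ⟨aemeasurable_const, MemLp.zero', by simp [energy]⟩
  smul_mem' := fun c _ hu => hu.const_mul c

lemma energy_symm {ν : E d → ℝ≥0} (hν : IsSymmLevyDensity ν) (A B : Set (E d)) (u : E d → ℝ) :
    energy ν A B u = energy ν B A u := by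
  have := (Measure.measurePreserving_swap (μ := (volume : Measure (E d)))
    (ν := (volume : Measure (E d)))).setLIntegral_comp_preimage_emb
      MeasurableEquiv.prodComm.measurableEmbedding
      (fun p => ENNReal.ofReal ((u p.1 - u p.2) ^ 2) * (ν (p.1 - p.2) : ℝ≥0∞)) (A ×ˢ B)
  rw [energy, ← this, Set.preimage_swap_prod, energy]
  refine lintegral_congr fun p => ?_
  simp only [Prod.fst_swap, Prod.snd_swap]
  rw [hν.sub_comm p.1 p.2, ← neg_sq (u p.2 - _), neg_sub]

/-- The sections of the diagonal are points, null since `d ≥ 1`; the kernel bounds are only assumed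
off the diagonal. -/
lemma ae_prod_ne (hd : 1 ≤ d) : ∀ᵐ p : E d × E d ∂(volume.prod volume), p.1 ≠ p.2 := by
  have : Nonempty (Fin d) := ⟨⟨0, hd⟩⟩
  rw [ae_iff]
  simp only [ne_eq, not_not]
  have hm : MeasurableSet {p : E d × E d | p.1 = p.2} :=
    measurableSet_eq_fun measurable_fst measurable_snd
  rw [Measure.measure_prod_null hm]
  refine Eventually.of_forall fun x => ?_
  have : Prod.mk x ⁻¹' {p : E d × E d | p.1 = p.2} = {x} := by
    ext y; simp [eq_comm]
  simp only [this, measure_singleton, Pi.zero_apply]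

section kernel

variable {ν : E d → ℝ≥0} {Λ : ℝ} {k : E d → E d → ℝ≥0}

lemma IsEllipticKernel.ae_bounds (hk : IsEllipticKernel ν Λ k) (hν : IsSymmLevyDensity ν)
    (hd : 1 ≤ d) (hΛ : 1 ≤ Λ) : ∀ᵐ p : E d × E d ∂(volume.prod volume),
      (k p.1 p.2 : ℝ≥0∞) ≤ Λ.toNNReal * ν (p.1 - p.2) ∧
      (ν (p.1 - p.2) : ℝ≥0∞) ≤ Λ.toNNReal * k p.1 p.2 := by
  filter_upwards [ae_prod_ne hd] with p hp
  have h0 : 0 < Λ := one_pos.trans_le hΛ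
  have h1 := hk.upper p.1 p.2 hp
  have h2 := hk.lower p.1 p.2 hp
  rw [hν.sub_comm p.1 p.2]
  rw [inv_mul_le_iff₀ h0] at h2
  constructor
  · rw [← ENNReal.coe_mul, ENNReal.coe_le_coe, ← NNReal.coe_le_coe, NNReal.coe_mul,
      Real.coe_toNNReal _ h0.le]
    exact h1
  · rw [← ENNReal.coe_mul, ENNReal.coe_le_coe, ← NNReal.coe_le_coe, NNReal.coe_mul,
      Real.coe_toNNReal _ h0.le]
    exact h2

/-- The measure `½ k(x,y) dx dy` on `(Ω^c × Ω^c)^c`. -/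
def kernelMeasure (Ω : Set (E d)) (k : E d → E d → ℝ≥0) : Measure (E d × E d) :=
  ((volume.prod volume).restrict (Ωᶜ ×ˢ Ωᶜ)ᶜ).withDensity fun p => ((k p.1 p.2 / 2 : ℝ≥0) : ℝ≥0∞)

/-- The measure `β(y) dy` on `Ω^c`. -/
def robinMeasure (Ω : Set (E d)) (β : E d → ℝ) : Measure (E d) :=
  (volume.restrict Ωᶜ).withDensity fun y => ((β y).toNNReal : ℝ≥0∞)

lemma kernelMeasure_absolutelyContinuous (Ω : Set (E d)) (k : E d → E d → ℝ≥0) :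
    kernelMeasure Ω k ≪ volume.prod volume :=
  (withDensity_absolutelyContinuous _ _).trans Measure.restrict_le_self.absolutelyContinuous

lemma robinMeasure_absolutelyContinuous (Ω : Set (E d)) (β : E d → ℝ) :
    robinMeasure Ω β ≪ volume :=
  (withDensity_absolutelyContinuous _ _).trans Measure.restrict_le_self.absolutelyContinuous

lemma aemeasurable_fst_sub_snd {u : E d → ℝ} (hu : AEMeasurable u volume) :
    AEMeasurable (fun p : E d × E d => u p.1 - u p.2) (volume.prod volume) :=
  (hu.comp_quasiMeasurePreserving Measure.quasiMeasurePreserving_fst).sub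
    (hu.comp_quasiMeasurePreserving Measure.quasiMeasurePreserving_snd)

lemma lintegral_kernelMeasure (hk : IsEllipticKernel ν Λ k) (Ω : Set (E d)) {u : E d → ℝ}
    (hu : AEMeasurable u volume) :
    ∫⁻ p, ENNReal.ofReal ((u p.1 - u p.2) ^ 2) ∂(kernelMeasure Ω k) =
      ∫⁻ p in (Ωᶜ ×ˢ Ωᶜ)ᶜ, ENNReal.ofReal ((u p.1 - u p.2) ^ 2) *
        ((k p.1 p.2 / 2 : ℝ≥0) : ℝ≥0∞) ∂(volume.prod volume) := by
  have hkm : AEMeasurable (fun p : E d × E d => ((k p.1 p.2 / 2 : ℝ≥0) : ℝ≥0∞))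
      ((volume.prod volume).restrict (Ωᶜ ×ˢ Ωᶜ)ᶜ) :=
    ((hk.aemeasurable.div_const 2).coe_nnreal_ennreal).restrict
  rw [kernelMeasure, lintegral_withDensity_eq_lintegral_mul₀ hkm
    ((aemeasurable_fst_sub_snd hu).pow_const 2).ennreal_ofReal.restrict]
  exact lintegral_congr fun p => mul_comm (_ : ℝ≥0∞) _

lemma lintegral_kernelMeasure_le (hk : IsEllipticKernel ν Λ k) (hν : IsSymmLevyDensity ν)
    (hd : 1 ≤ d) (hΛ : 1 ≤ Λ) (Ω : Set (E d)) {u : E d → ℝ} (hu : AEMeasurable u volume) :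
    ∫⁻ p, ENNReal.ofReal ((u p.1 - u p.2) ^ 2) ∂(kernelMeasure Ω k) ≤
      2 * Λ.toNNReal * energy ν Ω Set.univ u := by
  rw [lintegral_kernelMeasure hk Ω hu]
  -- The two strips have equal energy by symmetry of `ν`; hence the factor `2`.
  have hsub : (Ωᶜ ×ˢ Ωᶜ : Set (E d × E d))ᶜ ⊆ Ω ×ˢ Set.univ ∪ Set.univ ×ˢ Ω := by
    rintro ⟨x, y⟩ hp
    by_cases hx : x ∈ Ω
    · exact Or.inl ⟨hx, trivial⟩
    · refine Or.inr ⟨trivial, ?_⟩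
      by_contra hy
      exact hp ⟨hx, hy⟩
  refine (lintegral_mono_set hsub).trans ((lintegral_union_le _ _ _).trans ?_)
  have hle : ∀ S : Set (E d × E d), ∫⁻ p in S, ENNReal.ofReal ((u p.1 - u p.2) ^ 2) *
        ((k p.1 p.2 / 2 : ℝ≥0) : ℝ≥0∞) ∂(volume.prod volume) ≤ Λ.toNNReal *
      ∫⁻ p in S, ENNReal.ofReal ((u p.1 - u p.2) ^ 2) * (ν (p.1 - p.2) : ℝ≥0∞)
        ∂(volume.prod volume) := by
    intro S
    rw [← lintegral_const_mul' _ _ ENNReal.coe_ne_top]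
    refine lintegral_mono_ae ?_
    filter_upwards [ae_restrict_of_ae (hk.ae_bounds hν hd hΛ)] with p hp
    have h1 : ((k p.1 p.2 / 2 : ℝ≥0) : ℝ≥0∞) ≤ k p.1 p.2 :=
      ENNReal.coe_le_coe.2 (half_le_self bot_le)
    calc _ ≤ ENNReal.ofReal ((u p.1 - u p.2) ^ 2) * (Λ.toNNReal * ν (p.1 - p.2)) := by
          gcongr
          exact h1.trans hp.1
      _ = _ := by ring
  refine (add_le_add (hle _) (hle _)).trans (le_of_eq ?_)
  change Λ.toNNReal * energy ν Ω Set.univ u + Λ.toNNReal * energy ν Set.univ Ω u = _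
  rw [energy_symm hν Set.univ Ω]
  ring

lemma energy_le_lintegral_kernelMeasure (hk : IsEllipticKernel ν Λ k) (hν : IsSymmLevyDensity ν)
    (hd : 1 ≤ d) (hΛ : 1 ≤ Λ) (Ω : Set (E d)) {u : E d → ℝ} (hu : AEMeasurable u volume) :
    energy ν Ω Set.univ u ≤ 2 * Λ.toNNReal *
      ∫⁻ p, ENNReal.ofReal ((u p.1 - u p.2) ^ 2) ∂(kernelMeasure Ω k) := by
  rw [lintegral_kernelMeasure hk Ω hu, ← lintegral_const_mul' _ _
    (ENNReal.mul_ne_top (by simp) ENNReal.coe_ne_top)]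
  have hsub : Ω ×ˢ Set.univ ⊆ (Ωᶜ ×ˢ Ωᶜ : Set (E d × E d))ᶜ := fun p hp hp' => hp'.1 hp.1
  refine le_trans (lintegral_mono_ae ?_) (lintegral_mono_set hsub)
  filter_upwards [ae_restrict_of_ae (hk.ae_bounds hν hd hΛ)] with p hp
  have h2 : (k p.1 p.2 : ℝ≥0∞) = 2 * ((k p.1 p.2 / 2 : ℝ≥0) : ℝ≥0∞) := by
    rw [← ENNReal.coe_ofNat, ← ENNReal.coe_mul, mul_div_cancel₀ _ two_ne_zero]
  calc _ ≤ ENNReal.ofReal ((u p.1 - u p.2) ^ 2) * (Λ.toNNReal * k p.1 p.2) := by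
        gcongr
        exact hp.2
    _ = _ := by rw [h2]; ring

lemma lintegral_robinMeasure {Ω : Set (E d)} {β : E d → ℝ}
    (hβ : AEMeasurable β (volume.restrict Ωᶜ)) {u : E d → ℝ} (hu : AEMeasurable u volume) :
    ∫⁻ y, ENNReal.ofReal (u y ^ 2) ∂(robinMeasure Ω β) =
      ∫⁻ y in Ωᶜ, ENNReal.ofReal (u y ^ 2) * ENNReal.ofReal (β y) := by
  rw [robinMeasure, lintegral_withDensity_eq_lintegral_mul₀ hβ.real_toNNReal.coe_nnreal_ennreal
    (hu.pow_const 2).ennreal_ofReal.restrict]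
  exact lintegral_congr fun p => mul_comm (_ : ℝ≥0∞) _

end kernel

/-- The quadratic form attached to the measures `m₁` on pairs and `m₂` on points. -/
def quadForm (m₁ : Measure (E d × E d)) (m₂ : Measure (E d)) (u : E d → ℝ) : ℝ≥0∞ :=
  ∫⁻ p, ENNReal.ofReal ((u p.1 - u p.2) ^ 2) ∂m₁ + ∫⁻ y, ENNReal.ofReal (u y ^ 2) ∂m₂

/-- The quadratic form controls the norm of `V_ν(Ω|ℝ^d)` and the norm of `L²(ℝ^d, ν̃)`. -/
def IsCoerciveForm (ν : E d → ℝ≥0) (Ω B : Set (E d)) (T : ℝ≥0) (m₁ : Measure (E d × E d))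
    (m₂ : Measure (E d)) : Prop :=
  ∀ u, MemV ν Ω u →
    (∫⁻ x in Ω, ENNReal.ofReal (u x ^ 2)) + energy ν Ω Set.univ u ≤ T * quadForm m₁ m₂ u ∧
      ∫⁻ y, ENNReal.ofReal (u y ^ 2) * nuTilde ν B y ≤ T * quadForm m₁ m₂ u

lemma exists_isCoerciveForm {ν : E d → ℝ≥0} (hν : IsSymmLevyDensity ν)
    {Ω B : Set (E d)} (hd : 1 ≤ d) (hBΩ : B ⊆ Ω) {β : E d → ℝ}
    (hβm : AEMeasurable β (volume.restrict Ωᶜ)) {Λ : ℝ} (hΛ : 1 ≤ Λ) {c : ℝ≥0}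
    (hc : ∀ u, MemV ν Ω u → ∫⁻ x in Ω, ENNReal.ofReal (u x ^ 2) ≤
      c * (energy ν Ω Set.univ u +
        ∫⁻ y in Ωᶜ, ENNReal.ofReal (u y ^ 2) * ENNReal.ofReal (β y))) :
    ∃ T : ℝ≥0, 0 < T ∧ ∀ k : E d → E d → ℝ≥0, IsEllipticKernel ν Λ k →
      IsCoerciveForm ν Ω B T (kernelMeasure Ω k) (robinMeasure Ω β) := by
  set κ : ℝ≥0 := (∫⁻ h, min 1 (ν h : ℝ≥0∞)).toNNReal with hκ
  have hκc : (κ : ℝ≥0∞) = ∫⁻ h, min 1 (ν h : ℝ≥0∞) :=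
    ENNReal.coe_toNNReal (by simpa using (hν.lintegral_min_lt_top 1).ne)
  set A : ℝ≥0 := 2 * Λ.toNNReal with hA
  have hΛ' : 1 ≤ Λ.toNNReal := Real.one_le_toNNReal.2 hΛ
  have hA1 : 1 ≤ A := by
    rw [hA, two_mul]
    exact le_add_right hΛ'
  -- The two bounds cost `(1 + c)P` and `(2 + 2κc)P`; the sum of the factors serves for both, and `P
  -- ≤ A Q` with `A = 2Λ`. Nothing depends on `k`.
  refine ⟨(3 + c + 2 * κ * c) * A, by positivity, fun k hk u hu => ?_⟩
  set P := energy ν Ω Set.univ u +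
        ∫⁻ y in Ωᶜ, ENNReal.ofReal (u y ^ 2) * ENNReal.ofReal (β y) with hP
  have hPQ : P ≤ A * quadForm (kernelMeasure Ω k) (robinMeasure Ω β) u := by
    rw [quadForm, mul_add, hP]
    refine add_le_add ?_ ?_
    · have := energy_le_lintegral_kernelMeasure hk hν hd hΛ Ω hu.aemeasurable
      rw [hA]
      push_cast
      exact this
    · rw [← lintegral_robinMeasure hβm hu.aemeasurable]
      exact le_mul_of_one_le_left bot_le (by exact_mod_cast hA1)
  have hN := hc u hu
  have hEP : energy ν Ω Set.univ u ≤ P := le_self_add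
  push_cast
  constructor
  · calc _ ≤ c * P + P := add_le_add hN hEP
      _ ≤ (3 + c + 2 * κ * c) * P := by
        calc (c : ℝ≥0∞) * P + P ≤ c * P + P + (2 * P + 2 * κ * c * P) := le_self_add
          _ = _ := by ring
      _ ≤ (3 + c + 2 * κ * c) * (A * quadForm (kernelMeasure Ω k) (robinMeasure Ω β) u) := by
        gcongr
      _ = _ := by ring
  · calc _ ≤ 2 * energy ν B Set.univ u + 2 * κ * ∫⁻ x in B, ENNReal.ofReal (u x ^ 2) := by
          rw [hκc]
          exact lintegral_sq_mul_nuTilde_le hν hu.aemeasurable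
      _ ≤ 2 * P + 2 * κ * (c * P) := by
          gcongr
          · exact (energy_mono hBΩ subset_rfl u).trans hEP
          · exact (lintegral_mono_set hBΩ).trans hN
      _ ≤ (3 + c + 2 * κ * c) * P := by
        calc (2 : ℝ≥0∞) * P + 2 * κ * (c * P) ≤ 2 * P + 2 * κ * (c * P) + (P + c * P) :=
              le_self_add
          _ = _ := by ring
      _ ≤ (3 + c + 2 * κ * c) * (A * quadForm (kernelMeasure Ω k) (robinMeasure Ω β) u) := by
        gcongr
      _ = _ := by ring

/-! ### The form as an inner product, and completeness. -/

section energyMap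

variable {ν : E d → ℝ≥0} (hν : IsSymmLevyDensity ν) {Ω : Set (E d)}
  {m₁ : Measure (E d × E d)} {m₂ : Measure (E d)}
  (h₁ : ∀ u, MemV ν Ω u → MemLp (fun p : E d × E d => u p.1 - u p.2) 2 m₁)
  (h₂ : ∀ u, MemV ν Ω u → MemLp u 2 m₂)

/-- The map `u ↦ (u(x) - u(y), u)` from `V_ν(Ω|ℝ^d)` to `L²(m₁) × L²(m₂)`. -/
def energyMap : spaceV hν Ω →ₗ[ℝ] WithLp 2 (Lp ℝ 2 m₁ × Lp ℝ 2 m₂) where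
  toFun u := WithLp.toLp 2 ((h₁ u u.2).toLp _, (h₂ u u.2).toLp _)
  map_add' u v := by
    rw [← WithLp.toLp_add, Prod.mk_add_mk, ← MemLp.toLp_add, ← MemLp.toLp_add]
    congr 2
    refine MemLp.toLp_congr _ _ (Eventually.of_forall fun p => ?_)
    simp only [Submodule.coe_add, Pi.add_apply]
    ring
  map_smul' c u := by
    rw [RingHom.id_apply, ← WithLp.toLp_smul, Prod.smul_mk, ← MemLp.toLp_const_smul,
      ← MemLp.toLp_const_smul]
    congr 2
    refine MemLp.toLp_congr _ _ (Eventually.of_forall fun p => ?_)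
    simp only [Submodule.coe_smul, Pi.smul_apply, smul_eq_mul]
    ring

lemma ofReal_norm_energyMap_sq (u : spaceV hν Ω) :
    ENNReal.ofReal (‖energyMap hν h₁ h₂ u‖ ^ 2) = quadForm m₁ m₂ u := by
  rw [WithLp.prod_norm_sq_eq_of_L2, ENNReal.ofReal_add (sq_nonneg _) (sq_nonneg _), quadForm]
  change ENNReal.ofReal (‖(h₁ u u.2).toLp _‖ ^ 2) + ENNReal.ofReal (‖(h₂ u u.2).toLp _‖ ^ 2) = _
  rw [Lp.norm_toLp, Lp.norm_toLp, ENNReal.ofReal_pow ENNReal.toReal_nonneg,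
    ENNReal.ofReal_pow ENNReal.toReal_nonneg, ENNReal.ofReal_toReal (h₁ u u.2).2.ne,
    ENNReal.ofReal_toReal (h₂ u u.2).2.ne, sq_eLpNorm_two, sq_eLpNorm_two]

lemma inner_energyMap (u v : spaceV hν Ω) :
    (inner ℝ (energyMap hν h₁ h₂ u) (energyMap hν h₁ h₂ v) : ℝ) =
      (∫ p, (u.1 p.1 - u.1 p.2) * (v.1 p.1 - v.1 p.2) ∂m₁) + ∫ y, u.1 y * v.1 y ∂m₂ := by
  rw [WithLp.prod_inner_apply]
  change (inner ℝ ((h₁ u u.2).toLp _) ((h₁ v v.2).toLp _) : ℝ) +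
    inner ℝ ((h₂ u u.2).toLp _) ((h₂ v v.2).toLp _) = _
  rw [L2.inner_def, L2.inner_def]
  congr 1
  · refine integral_congr_ae ?_
    filter_upwards [(h₁ u u.2).coeFn_toLp, (h₁ v v.2).coeFn_toLp] with p hp hq
    rw [hp, hq]
    exact mul_comm _ _
  · refine integral_congr_ae ?_
    filter_upwards [(h₂ u u.2).coeFn_toLp, (h₂ v v.2).coeFn_toLp] with p hp hq
    rw [hp, hq]
    exact mul_comm _ _

/-- Coercivity makes `V_ν(Ω|ℝ^d)` complete for the quadratic form. -/
lemma isClosed_range_energyMap {B : Set (E d)} {T : ℝ≥0} (hT : IsCoerciveForm ν Ω B T m₁ m₂)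
    (hm₁ : m₁ ≪ volume.prod volume) (hm₂ : m₂ ≪ volume) (hpos : ∀ y, 0 < nuTilde ν B y) :
    IsClosed (LinearMap.range (energyMap hν h₁ h₂) : Set (WithLp 2 (Lp ℝ 2 m₁ × Lp ℝ 2 m₂))) := by
  refine IsSeqClosed.isClosed fun a h ha hlim => ?_
  choose u hu using ha
  -- As `ν̃ > 0`, convergence `μ`-a.e. is convergence a.e. on all of `ℝ^d`, so the limit is defined
  -- outside `Ω` too.
  set μ : Measure (E d) := volume.withDensity (nuTilde ν B) with hμ
  have hθ : AEMeasurable (nuTilde ν B) volume := aemeasurable_nuTilde hν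
  have hac : volume ≪ μ :=
    withDensity_absolutelyContinuous' hθ (Eventually.of_forall fun y => (hpos y).ne')
  have hμint : ∀ w : E d → ℝ, AEMeasurable w volume → ∫⁻ y, ENNReal.ofReal (w y ^ 2) ∂μ =
      ∫⁻ y, ENNReal.ofReal (w y ^ 2) * nuTilde ν B y := by
    intro w hw
    rw [hμ, lintegral_withDensity_eq_lintegral_mul₀ hθ (hw.pow_const 2).ennreal_ofReal]
    exact lintegral_congr fun p => mul_comm (_ : ℝ≥0∞) _
  have hbound : ∀ w : spaceV hν Ω, ∫⁻ y, ENNReal.ofReal (w.1 y ^ 2) ∂μ ≤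
      T * ENNReal.ofReal (‖energyMap hν h₁ h₂ w‖ ^ 2) := by
    intro w
    rw [hμint _ w.2.aemeasurable, ofReal_norm_energyMap_sq]
    exact (hT w w.2).2
  have huL : ∀ n, MemLp (u n).1 2 μ := fun n => memLp_two_iff.2
    ⟨(u n).2.aemeasurable.aestronglyMeasurable.mono_ac (withDensity_absolutelyContinuous _ _),
      (hbound _).trans_lt (ENNReal.mul_lt_top ENNReal.coe_lt_top ENNReal.ofReal_lt_top)⟩
  have hcau : ∀ ε : ℝ≥0, 0 < ε → ∃ N, ∀ i ≥ N, ∀ j ≥ N,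
      ∫⁻ x, ENNReal.ofReal (((u i).1 x - (u j).1 x) ^ 2) ∂μ ≤ ε := by
    intro ε hε
    -- Dividing by `T + 1` rather than `T` allows `T = 0`.
    set δ : ℝ := Real.sqrt (ε / (T + 1)) with hδ
    have hδ0 : 0 < δ := Real.sqrt_pos.2 (by positivity)
    obtain ⟨N, hN⟩ := Metric.cauchySeq_iff.1 hlim.cauchySeq δ hδ0
    refine ⟨N, fun i hi j hj => (hbound (u i - u j)).trans ?_⟩
    have h1 : ‖energyMap hν h₁ h₂ (u i - u j)‖ ≤ δ := by
      rw [map_sub, hu, hu, ← dist_eq_norm]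
      exact (hN i hi j hj).le
    have h2 : ‖energyMap hν h₁ h₂ (u i - u j)‖ ^ 2 ≤ ε / (T + 1) := by
      refine (pow_le_pow_left₀ (norm_nonneg _) h1 2).trans (le_of_eq ?_)
      rw [hδ, Real.sq_sqrt (by positivity)]
    rw [← ENNReal.ofReal_coe_nnreal (p := T), ← ENNReal.ofReal_mul T.coe_nonneg,
      ← ENNReal.ofReal_coe_nnreal (p := ε)]
    refine ENNReal.ofReal_le_ofReal ?_
    calc (T : ℝ) * ‖energyMap hν h₁ h₂ (u i - u j)‖ ^ 2 ≤ (T + 1) * (ε / (T + 1)) := by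
          gcongr
          linarith
      _ = ε := by field_simp
  obtain ⟨g, hgL, -, ψ, hψ, hgae⟩ := exists_limit_of_cauchy huL hcau
  have hgae := hac.ae_le hgae
  obtain ⟨R, hR⟩ := hlim.norm.bddAbove_range
  have hR : ∀ n, ‖a n‖ ≤ R := fun n => hR ⟨n, rfl⟩
  have hquad : ∀ n, (∫⁻ x in Ω, ENNReal.ofReal ((u n).1 x ^ 2)) + energy ν Ω Set.univ (u n).1 ≤
      T * ENNReal.ofReal (R ^ 2) := by
    intro n
    refine (hT (u n) (u n).2).1.trans ?_
    rw [← ofReal_norm_energyMap_sq hν h₁ h₂ (u n), hu]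
    gcongr
    exact hR n
  have hfin : T * ENNReal.ofReal (R ^ 2) < ∞ :=
    ENNReal.mul_lt_top ENNReal.coe_lt_top ENNReal.ofReal_lt_top
  have hgm : AEMeasurable g volume := hgL.1.aemeasurable.mono_ac hac
  -- Fatou's lemma, with the uniform bounds that coercivity draws from boundedness of the images.
  have hg : MemV ν Ω g := by
    refine ⟨hgm, memLp_two_iff.2 ⟨hgm.restrict.aestronglyMeasurable, lt_of_le_of_lt ?_ hfin⟩,
      lt_of_le_of_lt ?_ hfin⟩
    · have hF := lintegral_liminf_le' (μ := volume.restrict Ω) (u := atTop)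
        (f := fun n x => ENNReal.ofReal ((u (ψ n)).1 x ^ 2))
        (fun n => ((u (ψ n)).2.aemeasurable.restrict.pow_const 2).ennreal_ofReal)
      refine le_trans (le_of_eq ?_) (hF.trans (liminf_le_of_frequently_le'
        (Frequently.of_forall fun n => le_self_add.trans (hquad (ψ n)))))
      refine lintegral_congr_ae ?_
      filter_upwards [ae_restrict_of_ae hgae] with x hx
      exact (ENNReal.tendsto_ofReal (hx.pow 2)).liminf_eq.symm
    · refine (energy_le_liminf hν (u := fun n => (u (ψ n)).1)
        (fun n => (u (ψ n)).2.aemeasurable.restrict)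
        (fun n => (u (ψ n)).2.aemeasurable.restrict) (ae_restrict_of_ae hgae)
        (ae_restrict_of_ae hgae)).trans ?_
      exact liminf_le_of_frequently_le'
        (Frequently.of_forall fun n => le_add_self.trans (hquad (ψ n)))
  refine ⟨⟨g, hg⟩, ?_⟩
  have hlimψ : Tendsto (fun n => energyMap hν h₁ h₂ (u (ψ n))) atTop (𝓝 h) := by
    simp only [hu]
    exact hlim.comp hψ.tendsto_atTop
  have hf1 : (h₁ g hg).toLp _ = h.fst := by
    refine toLp_eq_of_tendsto (fun n => h₁ _ (u (ψ n)).2) (h₁ g hg)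
      (((WithLp.prod_continuous_ofLp 2 _ _).fst.tendsto h).comp hlimψ) ?_
    refine hm₁.ae_le ?_
    filter_upwards [ae_prod_of_ae_fst hgae, ae_prod_of_ae_snd hgae] with p hp hq
    exact hp.sub hq
  have hf2 : (h₂ g hg).toLp _ = h.snd := by
    refine toLp_eq_of_tendsto (fun n => h₂ _ (u (ψ n)).2) (h₂ g hg)
      (((WithLp.prod_continuous_ofLp 2 _ _).snd.tendsto h).comp hlimψ) ?_
    exact hm₂.ae_le hgae
  change WithLp.toLp 2 ((h₁ g hg).toLp _, (h₂ g hg).toLp _) = h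
  rw [hf1, hf2]
  rfl

end energyMap

/-! ### Boundedness of the form and of the data. -/

lemma robinForm_eq {ν : E d → ℝ≥0} {Λ : ℝ} {k : E d → E d → ℝ≥0} (hk : IsEllipticKernel ν Λ k)
    {Ω : Set (E d)} (hΩ : MeasurableSet Ω) {β : E d → ℝ}
    (hβm : AEMeasurable β (volume.restrict Ωᶜ)) (hβ0 : ∀ y ∈ Ωᶜ, 0 ≤ β y) (u v : E d → ℝ) :
    robinForm Ω k β u v = (∫ p, (u p.1 - u p.2) * (v p.1 - v p.2) ∂(kernelMeasure Ω k)) +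
      ∫ y, u y * v y ∂(robinMeasure Ω β) := by
  rw [robinForm, form, kernelMeasure, robinMeasure,
    integral_withDensity_eq_integral_smul₀ (hk.aemeasurable.div_const 2).restrict,
    integral_withDensity_eq_integral_smul₀ hβm.real_toNNReal, ← integral_const_mul]
  congr 1
  · refine integral_congr_ae (Eventually.of_forall fun p => ?_)
    simp only [NNReal.smul_def, NNReal.coe_div, NNReal.coe_ofNat, smul_eq_mul]
    ring
  · refine setIntegral_congr_fun hΩ.compl fun y hy => ?_
    simp only [NNReal.smul_def, smul_eq_mul, Real.coe_toNNReal _ (hβ0 y hy)]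
    ring

/-- Weighted Cauchy–Schwarz inequality for the Bochner integral. -/
lemma integrable_mul_and_abs_integral_le {α : Type*} [MeasurableSpace α] {μ : Measure α}
    {θ : α → ℝ≥0∞} (hθ : AEMeasurable θ μ) (hθ0 : ∀ x, θ x ≠ 0) (hθt : ∀ x, θ x ≠ ∞)
    {g u : α → ℝ} (hg : MemLp g 2 (μ.withDensity fun x => (θ x)⁻¹)) (hu : AEMeasurable u μ)
    (huL : eLpNorm u 2 (μ.withDensity θ) ≠ ∞) :
    Integrable (fun x => g x * u x) μ ∧ |∫ x, g x * u x ∂μ| ≤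
      (eLpNorm g 2 (μ.withDensity fun x => (θ x)⁻¹)).toReal *
        (eLpNorm u 2 (μ.withDensity θ)).toReal := by
  have hac : μ ≪ μ.withDensity fun x => (θ x)⁻¹ :=
    withDensity_absolutelyContinuous' hθ.inv
      (Eventually.of_forall fun x => ENNReal.inv_ne_zero.2 (hθt x))
  have hgm : AEMeasurable g μ := hg.1.aemeasurable.mono_ac hac
  have hle := lintegral_enorm_mul_le hθ hθ0 hθt hgm hu
  have hfin := ENNReal.mul_lt_top hg.2 huL.lt_top
  refine ⟨⟨(hgm.mul hu).aestronglyMeasurable, hle.trans_lt hfin⟩, ?_⟩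
  rw [← ENNReal.toReal_mul, ← Real.norm_eq_abs, ← toReal_enorm]
  exact ENNReal.toReal_mono hfin.ne ((enorm_integral_le_lintegral_enorm _).trans hle)

lemma memLp_kernelMeasure {ν : E d → ℝ≥0} {Λ : ℝ} {k : E d → E d → ℝ≥0}
    (hk : IsEllipticKernel ν Λ k) (hν : IsSymmLevyDensity ν) (hd : 1 ≤ d) (hΛ : 1 ≤ Λ)
    {Ω : Set (E d)} {u : E d → ℝ} (hu : MemV ν Ω u) :
    MemLp (fun p : E d × E d => u p.1 - u p.2) 2 (kernelMeasure Ω k) :=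
  memLp_two_iff.2 ⟨(aemeasurable_fst_sub_snd hu.aemeasurable).aestronglyMeasurable.mono_ac
    (kernelMeasure_absolutelyContinuous Ω k),
    (lintegral_kernelMeasure_le hk hν hd hΛ Ω hu.aemeasurable).trans_lt
      (ENNReal.mul_lt_top (ENNReal.mul_lt_top (by simp) ENNReal.coe_lt_top) hu.energy_lt_top)⟩

/-- Since `β ≤ Mν̃` a.e. on `Ω^c`, the trace inequality gives finiteness. -/
lemma memLp_robinMeasure {ν : E d → ℝ≥0} (hν : IsSymmLevyDensity ν) {Ω B : Set (E d)}
    (hBΩ : B ⊆ Ω) (hpos : ∀ y, 0 < nuTilde ν B y) {β : E d → ℝ}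
    (hβm : AEMeasurable β (volume.restrict Ωᶜ)) {M : ℝ≥0}
    (hM : ∀ᵐ y ∂(volume.restrict Ωᶜ), ENNReal.ofReal (β y) * (nuTilde ν B y)⁻¹ ≤ (M : ℝ≥0∞))
    {u : E d → ℝ} (hu : MemV ν Ω u) : MemLp u 2 (robinMeasure Ω β) := by
  refine memLp_two_iff.2 ⟨hu.aemeasurable.aestronglyMeasurable.mono_ac
    (robinMeasure_absolutelyContinuous Ω β), ?_⟩
  rw [lintegral_robinMeasure hβm hu.aemeasurable]
  refine (lintegral_sq_mul_le hν hM hpos u).trans_lt (ENNReal.mul_lt_top ENNReal.coe_lt_top ?_)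
  refine (lintegral_sq_mul_nuTilde_le hν hu.aemeasurable).trans_lt ?_
  have hκ : ∫⁻ h, min 1 (ν h : ℝ≥0∞) < ∞ := by simpa using hν.lintegral_min_lt_top 1
  refine ENNReal.add_lt_top.2 ⟨ENNReal.mul_lt_top (by simp) ?_,
    ENNReal.mul_lt_top (ENNReal.mul_lt_top (by simp) hκ) ?_⟩
  · exact (energy_mono hBΩ subset_rfl u).trans_lt hu.energy_lt_top
  · exact (lintegral_mono_set hBΩ).trans_lt (memLp_two_iff.1 hu.memLp).2

lemma toReal_le_sqrt_mul {e : ℝ≥0∞} {T : ℝ≥0} {r : ℝ} (hr : 0 ≤ r)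
    (h : e ^ 2 ≤ T * ENNReal.ofReal (r ^ 2)) : e.toReal ≤ Real.sqrt T * r := by
  have h1 := ENNReal.toReal_mono (ENNReal.mul_ne_top ENNReal.coe_ne_top ENNReal.ofReal_ne_top) h
  rw [ENNReal.toReal_pow, ENNReal.toReal_mul, ENNReal.coe_toReal,
    ENNReal.toReal_ofReal (sq_nonneg r)] at h1
  refine (pow_le_pow_iff_left₀ ENNReal.toReal_nonneg (by positivity) two_ne_zero).1 ?_
  rwa [mul_pow, Real.sq_sqrt T.coe_nonneg]

end NonlocalRobin

end

/-! ### Existence, uniqueness and the estimate. -/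

open NonlocalRobin in
theorem mainTheorem9 {d : ℕ} (hd : 1 ≤ d)
    (Ω : Set (NonlocalRobin.E d)) (hΩ_open : IsOpen Ω) (hΩ_bdd : Bornology.IsBounded Ω)
    (ν : NonlocalRobin.E d → ℝ≥0)
    (hν : NonlocalRobin.IsSymmLevyDensity ν)
    (hν_supp : NonlocalRobin.HasFullSupport ν)
    (hν_int : ∫⁻ h, (ν h : ℝ≥0∞) = ∞)
    (hclass : NonlocalRobin.ClassA1 ν Ω ∨ NonlocalRobin.ClassA2 ν Ω ∨ NonlocalRobin.ClassA3 ν Ω)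
    (B : Set (NonlocalRobin.E d)) (hB_open : IsOpen B) (hB_ne : B.Nonempty) (hBΩ : B ⊆ Ω)
    (Λ : ℝ) (hΛ : 1 ≤ Λ)
    (β : NonlocalRobin.E d → ℝ) (hβ_meas : AEMeasurable β (volume.restrict Ωᶜ))
    (hβ_nonneg : ∀ y ∈ Ωᶜ, 0 ≤ β y)
    (hβ_bdd : ∃ M : ℝ≥0, ∀ᵐ y ∂(volume.restrict Ωᶜ),
      ENNReal.ofReal (β y) * (NonlocalRobin.nuTilde ν B y)⁻¹ ≤ (M : ℝ≥0∞))
    (hβ_pos : 0 < volume (Ωᶜ ∩ {y | 0 < β y})) :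
    ∃ C : ℝ, 0 < C ∧
      ∀ k : NonlocalRobin.E d → NonlocalRobin.E d → ℝ≥0,
        NonlocalRobin.IsEllipticKernel ν Λ k →
      ∀ f g : NonlocalRobin.E d → ℝ,
        MemLp f 2 (volume.restrict Ω) →
        MemLp g 2 (NonlocalRobin.invWeightMeasure ν B Ω) →
        ∃ u : NonlocalRobin.E d → ℝ,
          NonlocalRobin.IsWeakRobinSolution ν Ω k β f g u ∧
          (∀ w : NonlocalRobin.E d → ℝ,
            NonlocalRobin.IsWeakRobinSolution ν Ω k β f g w → w =ᵐ[volume] u) ∧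
          NonlocalRobin.normV ν Ω u ≤
            C * ((eLpNorm f 2 (volume.restrict Ω)).toReal +
              (eLpNorm g 2 (NonlocalRobin.invWeightMeasure ν B Ω)).toReal) := by
  obtain ⟨M, hM⟩ := hβ_bdd
  have hpos := nuTilde_pos hν hν_supp hB_open hB_ne
  have hθ : AEMeasurable (nuTilde ν B) volume := aemeasurable_nuTilde hν
  have hθt : ∀ y, nuTilde ν B y ≠ ∞ := fun y => (nuTilde_lt_top hν y).ne
  obtain ⟨c, hc⟩ := exists_poincare_robin hν hν_supp hd hΩ_open hΩ_bdd hν_int hclass hB_open hB_ne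
    hBΩ hβ_meas hM hβ_pos
  obtain ⟨T, hT0, hT⟩ := exists_isCoerciveForm hν hd hBΩ hβ_meas hΛ hc
  -- `T = √T · √T`: one factor bounds the functional by `‖ι v‖`, the other bounds the `V` norm of
  -- the solution by `‖ι u‖`.
  refine ⟨T, by exact_mod_cast hT0, fun k hk f g hf hg => ?_⟩
  have hTk := hT k hk
  have h₁ : ∀ u, MemV ν Ω u → MemLp (fun p : E d × E d => u p.1 - u p.2) 2 (kernelMeasure Ω k) :=
    fun u hu => memLp_kernelMeasure hk hν hd hΛ hu
  have h₂ : ∀ u, MemV ν Ω u → MemLp u 2 (robinMeasure Ω β) :=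
    fun u hu => memLp_robinMeasure hν hBΩ hpos hβ_meas hM hu
  set ι := energyMap hν h₁ h₂ with hι
  have hnorm := ofReal_norm_energyMap_sq hν h₁ h₂
  have hform : ∀ u v : spaceV hν Ω, robinForm Ω k β u.1 v.1 = inner ℝ (ι u) (ι v) := fun u v => by
    rw [hι, inner_energyMap, robinForm_eq hk hΩ_open.measurableSet hβ_meas hβ_nonneg]
  have hΩL : ∀ u : spaceV hν Ω,
      (eLpNorm u.1 2 (volume.restrict Ω)).toReal ≤ Real.sqrt T * ‖ι u‖ := fun u => by
    refine toReal_le_sqrt_mul (norm_nonneg _) ?_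
    rw [sq_eLpNorm_two, hnorm]
    exact le_self_add.trans (hTk u u.2).1
  have hcL2 : ∀ u : spaceV hν Ω,
      eLpNorm u.1 2 ((volume.restrict Ωᶜ).withDensity (nuTilde ν B)) ^ 2 ≤
        T * ENNReal.ofReal (‖ι u‖ ^ 2) := fun u => by
    rw [sq_eLpNorm_two, hnorm, lintegral_withDensity_eq_lintegral_mul₀ hθ.restrict
      (u.2.aemeasurable.restrict.pow_const 2).ennreal_ofReal]
    refine le_trans ?_ (hTk u u.2).2
    refine le_trans (le_of_eq ?_) (setLIntegral_le_lintegral Ωᶜ _)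
    exact lintegral_congr fun p => mul_comm (_ : ℝ≥0∞) _
  have hfI : ∀ u : spaceV hν Ω, Integrable (fun x => f x * u.1 x) (volume.restrict Ω) ∧
      |∫ x in Ω, f x * u.1 x| ≤ (eLpNorm f 2 (volume.restrict Ω)).toReal *
        (eLpNorm u.1 2 (volume.restrict Ω)).toReal := by
    intro u
    -- The source term in `Ω` is the weighted Cauchy–Schwarz inequality with weight `1`.
    have h1 : (volume.restrict Ω).withDensity (fun _ => 1) = volume.restrict Ω := withDensity_one
    have := integrable_mul_and_abs_integral_le (μ := volume.restrict Ω) (θ := fun _ => 1)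
      aemeasurable_const (by simp) (by simp) (g := f) (u := u.1) (by simpa [h1] using hf)
      u.2.aemeasurable.restrict (by rw [h1]; exact u.2.memLp.2.ne)
    simpa only [inv_one, h1] using this
  have hgI : ∀ u : spaceV hν Ω, Integrable (fun x => g x * u.1 x) (volume.restrict Ωᶜ) ∧
      |∫ x in Ωᶜ, g x * u.1 x| ≤ (eLpNorm g 2 (invWeightMeasure ν B Ω)).toReal *
        (eLpNorm u.1 2 ((volume.restrict Ωᶜ).withDensity (nuTilde ν B))).toReal := by
    intro u
    refine integrable_mul_and_abs_integral_le hθ.restrict (fun y => (hpos y).ne') hθt hg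
      u.2.aemeasurable.restrict fun h => ?_
    have := hcL2 u
    rw [h, ENNReal.top_pow two_ne_zero] at this
    exact ENNReal.mul_ne_top ENNReal.coe_ne_top ENNReal.ofReal_ne_top (top_le_iff.1 this)
  set F := (eLpNorm f 2 (volume.restrict Ω)).toReal with hF
  set G := (eLpNorm g 2 (invWeightMeasure ν B Ω)).toReal with hG
  have hF0 : 0 ≤ F := ENNReal.toReal_nonneg
  have hG0 : 0 ≤ G := ENNReal.toReal_nonneg
  let ℓ : spaceV hν Ω →ₗ[ℝ] ℝ :=
    { toFun := fun u => (∫ x in Ω, f x * u.1 x) + ∫ y in Ωᶜ, g y * u.1 y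
      map_add' := fun u v => by
        simp only [Submodule.coe_add, Pi.add_apply, mul_add]
        rw [integral_add (hfI u).1 (hfI v).1, integral_add (hgI u).1 (hgI v).1]
        ring
      map_smul' := fun a u => by
        simp only [Submodule.coe_smul, Pi.smul_apply, smul_eq_mul, RingHom.id_apply, mul_add,
          ← integral_const_mul, mul_left_comm] }
  have hℓ : ∀ v, |ℓ v| ≤ Real.sqrt T * (F + G) * ‖ι v‖ := by
    intro v
    calc |ℓ v| ≤ |∫ x in Ω, f x * v.1 x| + |∫ y in Ωᶜ, g y * v.1 y| := abs_add_le _ _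
      _ ≤ F * (Real.sqrt T * ‖ι v‖) + G * (Real.sqrt T * ‖ι v‖) := by
          refine add_le_add ((hfI v).2.trans ?_) ((hgI v).2.trans ?_)
          · exact mul_le_mul_of_nonneg_left (hΩL v) hF0
          · exact mul_le_mul_of_nonneg_left (toReal_le_sqrt_mul (norm_nonneg _) (hcL2 v)) hG0
      _ = _ := by ring
  obtain ⟨u, hunorm, hu⟩ := exists_inner_eq_of_isClosed_range ι
    (isClosed_range_energyMap hν h₁ h₂ hTk (kernelMeasure_absolutelyContinuous Ω k)
      (robinMeasure_absolutelyContinuous Ω β) hpos) ℓ (by positivity) hℓ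
  refine ⟨u, ⟨u.2, fun v hv => (hform u ⟨v, hv⟩).trans (hu ⟨v, hv⟩)⟩, fun w hw => ?_, ?_⟩
  -- Testing both equations with the difference `z` gives `ι z = 0`; coercivity in `L²(ℝ^d, ν̃)`
  -- then kills `z` a.e. on the whole space.
  · set z : spaceV hν Ω := ⟨w, hw.1⟩ - u with hz
    have h0 : (inner ℝ (ι z) (ι z) : ℝ) = 0 := by
      have h1 : (inner ℝ (ι ⟨w, hw.1⟩) (ι z) : ℝ) = ℓ z := by
        rw [← hform]
        exact hw.2 z z.2
      have h2 : ι z = ι ⟨w, hw.1⟩ - ι u := map_sub ι _ _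
      rw [← sub_eq_zero.2 (h1.trans (hu z).symm), ← inner_sub_left, ← h2]
    have hz0 : ι z = 0 := inner_self_eq_zero.1 h0
    have h3 := (hTk z z.2).2
    rw [← hnorm z, ← hι, hz0, norm_zero, zero_pow two_ne_zero, ENNReal.ofReal_zero, mul_zero] at h3
    have h4 := (lintegral_eq_zero_iff'
      ((z.2.aemeasurable.pow_const 2).ennreal_ofReal.mul hθ)).1 (le_antisymm h3 bot_le)
    filter_upwards [h4] with y hy
    have h5 := (mul_eq_zero.1 hy).resolve_right (hpos y).ne'
    rw [ENNReal.ofReal_eq_zero] at h5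
    have h6 : z.1 y = 0 := (pow_eq_zero_iff two_ne_zero).1 (le_antisymm h5 (sq_nonneg _))
    exact sub_eq_zero.1 h6
  · have h1 : normV ν Ω u.1 ≤ Real.sqrt T * ‖ι u‖ := by
      refine Real.sqrt_le_iff.2 ⟨by positivity, ?_⟩
      have h2 := (hTk u u.2).1
      rw [← hnorm u, ← hι, ← sq_eLpNorm_two] at h2
      have h3 := ENNReal.toReal_mono
        (ENNReal.mul_ne_top ENNReal.coe_ne_top ENNReal.ofReal_ne_top) h2
      rw [ENNReal.toReal_add (ENNReal.pow_ne_top u.2.memLp.2.ne) u.2.energy_lt_top.ne,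
        ENNReal.toReal_pow, ENNReal.toReal_mul, ENNReal.coe_toReal,
        ENNReal.toReal_ofReal (sq_nonneg _)] at h3
      rwa [mul_pow, Real.sq_sqrt T.coe_nonneg]
    calc normV ν Ω u.1 ≤ Real.sqrt T * (Real.sqrt T * (F + G)) :=
          h1.trans (mul_le_mul_of_nonneg_left hunorm (Real.sqrt_nonneg _))
      _ = T * (F + G) := by rw [← mul_assoc, Real.mul_self_sqrt T.coe_nonneg]
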